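/- Work with tame link diagrams on the plane $\mathbb{R}^2$. The projection of an $n$-component diagram $L=K_1\cup\cdots\cup K_n$ (with $n\ge 0$) is the image, under a homeomorphism of $\mathbb{R}^2$ onto itself, of $n$ closed polygons in general position: a vertex lies on no edge other than the two edges that end there, and no point lies on three edges. The images of the points where two distinct non-consecutive edges meet are the crossing points of $L$, and at each of them it is specified which strand crosses over the other. There are finitely many crossing points, $C_1,\dots,C_c$. The projection may be disconnected (so $L$ may be a split diagram), and components without crossings are allowed. The regions of $L$ are the connected components of the complement of the projection in $\mathbb{R}^2$, the unbounded one included. Proposition. Let $L=K_1\cup\cdots\cup K_n$ be an $n$-component link diagram on the plane. Then $L$ has finitely many regions $R_1,\dots,R_r$. Let $M_L=(m_{ij})$ be the (original) incidence matrix of $L$, that is, the $r\times c$ matrix over $\mathbb{Z}_2=\mathbb{Z}/2\mathbb{Z}$ with $m_{ij}=1$ if the crossing point $C_j$ lies on the boundary of the region $R_i$ (also if $R_i$ touches $C_j$ from two sides), and $m_{ij}=0$ otherwise. Then $$\operatorname{rank}_{\mathbb{Z}_2}(M_L)=r-n-1 .$$ -/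

import Mathlib

/-- The Euclidean plane. -/
abbrev Plane : Type := EuclideanSpace ℝ (Fin 2)

/-- `n` closed polygons in the plane, not yet assumed to be in general position. The `i`-th
polygon has the cyclically ordered vertices `vertex i j`, `j : ZMod (size i)`. -/
structure PolygonSystem (n : ℕ) where
  /-- the number of vertices of each polygon -/
  size : Fin n → ℕ
  three_le_size : ∀ i, 3 ≤ size i
  /-- the vertices of each polygon, in cyclic order -/
  vertex : (i : Fin n) → ZMod (size i) → Plane

namespace PolygonSystem

variable {n : ℕ} (P : PolygonSystem n)

/-- Labels of edges: `⟨i, j⟩` is the edge of the `i`-th polygon from vertex `j` to `j + 1`. -/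
abbrev Edge : Type := Σ i : Fin n, ZMod (P.size i)

/-- The edge following `e` on its polygon. -/
def next (e : P.Edge) : P.Edge := ⟨e.1, e.2 + 1⟩

/-- The initial vertex of an edge. -/
def start (e : P.Edge) : Plane := P.vertex e.1 e.2

/-- The closed segment in the plane traced by an edge. -/
def seg (e : P.Edge) : Set Plane := segment ℝ (P.start e) (P.start (P.next e))

/-- The union of all the polygons. -/
def support : Set Plane := ⋃ e, P.seg e

/-- The points where two distinct, non-consecutive edges meet. -/
def doublePoints : Set Plane :=
  {p | ∃ e f : P.Edge, e ≠ f ∧ P.next e ≠ f ∧ P.next f ≠ e ∧ p ∈ P.seg e ∧ p ∈ P.seg f}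

/-- General position of a system of polygons (a regular polygonal projection): a vertex lies on
no edge other than the two edges that end there, and no point lies on three edges. In particular
edges are nondegenerate, consecutive edges meet only in their common vertex, and two distinct
non-consecutive edges are disjoint or cross in exactly one point, interior to both. -/
structure IsRegular : Prop where
  start_mem_seg : ∀ e f : P.Edge, P.start e ∈ P.seg f → f = e ∨ P.next f = e
  no_triple_point : ∀ (e f g : P.Edge) (p : Plane),
    p ∈ P.seg e → p ∈ P.seg f → p ∈ P.seg g → e = f ∨ f = g ∨ e = g

instance instNeZeroSize (i : Fin n) : NeZero (P.size i) :=
  ⟨by have := P.three_le_size i; omega⟩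

theorem next_injective : Function.Injective P.next := by
  rintro ⟨i, j⟩ ⟨k, l⟩ h
  obtain ⟨rfl, h⟩ := Sigma.mk.inj_iff.mp h
  have h' : j = l := by simpa using h
  rw [h']

/-- Two segments that share two distinct points overlap in an end point. -/
theorem endpoint_mem_of_two_common {a b c d p q : Plane} (hpq : p ≠ q)
    (hp : p ∈ segment ℝ a b) (hq : q ∈ segment ℝ a b)
    (hp' : p ∈ segment ℝ c d) (hq' : q ∈ segment ℝ c d) :
    a ∈ segment ℝ c d ∨ b ∈ segment ℝ c d ∨ c ∈ segment ℝ a b := by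
  rw [segment_eq_image'] at *
  obtain ⟨s, ⟨hs0, hs1⟩, rfl⟩ := hp
  obtain ⟨t, ⟨ht0, ht1⟩, rfl⟩ := hq
  obtain ⟨u, ⟨hu0, hu1⟩, hu⟩ := hp'
  obtain ⟨w, ⟨hw0, hw1⟩, hw⟩ := hq'
  simp only at hu hw hpq
  have huw : w - u ≠ 0 := by
    intro h
    rw [sub_eq_zero] at h
    subst h
    exact hpq (hu.symm.trans hw)
  have hst : t - s ≠ 0 := by
    intro h
    rw [sub_eq_zero] at h
    subst h
    exact hpq rfl
  have h1 : (w - u) • (d - c) = (t - s) • (b - a) := by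
    have h2 : (c + w • (d - c)) - (c + u • (d - c)) = (a + t • (b - a)) - (a + s • (b - a)) := by
      rw [hu, hw]
    rw [sub_smul, sub_smul]
    simpa using h2
  obtain ⟨r, hr0, hr⟩ : ∃ r : ℝ, r ≠ 0 ∧ d - c = r • (b - a) := by
    refine ⟨(w - u)⁻¹ * (t - s), mul_ne_zero (inv_ne_zero huw) hst, ?_⟩
    rw [mul_smul, ← h1, smul_smul, inv_mul_cancel₀ huw, one_smul]
  have hc : c = a + (s - u * r) • (b - a) := by
    rw [hr, smul_smul] at hu
    rw [sub_smul, ← add_sub_assoc, ← hu, add_sub_cancel_right]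
  have key : ∀ x : ℝ, c + ((x - (s - u * r)) / r) • (d - c) = a + x • (b - a) := by
    intro x
    rw [hr, smul_smul, div_mul_cancel₀ _ hr0, hc, add_assoc, ← add_smul]
    congr 2
    ring
  rcases lt_or_ge (s - u * r) 0 with hm | hm
  · left
    have hrp : 0 < r := by
      by_contra hneg
      nlinarith
    refine ⟨_, ⟨?_, ?_⟩, (key 0).trans (by simp)⟩
    · apply div_nonneg <;> linarith
    · rw [div_le_one hrp]; nlinarith
  · rcases lt_or_ge 1 (s - u * r) with hm1 | hm1
    · right; left
      have hrn : r < 0 := by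
        by_contra hneg
        nlinarith
      refine ⟨_, ⟨?_, ?_⟩, (key 1).trans (by simp)⟩
      · apply div_nonneg_of_nonpos <;> linarith
      · rw [div_le_one_of_neg hrn]; nlinarith
    · right; right
      rw [segment_eq_image']
      exact ⟨s - u * r, ⟨hm, hm1⟩, hc.symm⟩

theorem IsRegular.finite_doublePoints {P : PolygonSystem n} (hP : P.IsRegular) :
    P.doublePoints.Finite := by
  classical
  have hsub : P.doublePoints ⊆ ⋃ ef : P.Edge × P.Edge,
      {p | ef.1 ≠ ef.2 ∧ P.next ef.1 ≠ ef.2 ∧ P.next ef.2 ≠ ef.1 ∧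
        p ∈ P.seg ef.1 ∧ p ∈ P.seg ef.2} := by
    rintro p ⟨e, f, h⟩
    exact Set.mem_iUnion.mpr ⟨(e, f), h⟩
  have hfin : ∀ i, Finite (ZMod (P.size i)) := fun i => inferInstance
  refine (Set.finite_iUnion fun ef => Set.Subsingleton.finite ?_).subset hsub
  rintro p ⟨h1, h2, h3, hp, hp'⟩ q ⟨-, -, -, hq, hq'⟩
  by_contra hpq
  rcases endpoint_mem_of_two_common hpq hp hq hp' hq' with h | h | h
  · rcases hP.start_mem_seg _ _ h with h | h
    · exact h1 h.symm
    · exact h3 h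
  · rcases hP.start_mem_seg _ _ h with h | h
    · exact h2 h.symm
    · exact h1 (P.next_injective h).symm
  · rcases hP.start_mem_seg _ _ h with h | h
    · exact h1 h
    · exact h2 h

end PolygonSystem

/-- A (tame) diagram of an `n`-component link on the plane: the image, under a homeomorphism of
the plane onto itself, of a regular system of `n` closed polygons, together with the choice of an
overcrossing strand at each double point. The projection may be disconnected, and components
without crossings are allowed. -/
structure LinkDiagram (n : ℕ) where
  /-- the underlying system of polygons, one for each link component -/
  polygons : PolygonSystem n
  isRegular : polygons.IsRegular
  /-- the homeomorphism of the plane that carries the polygons to the diagram -/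
  homeo : Plane ≃ₜ Plane
  /-- the overcrossing edge at each double point -/
  overEdge : polygons.doublePoints → polygons.Edge
  mem_seg_overEdge : ∀ p : polygons.doublePoints, (p : Plane) ∈ polygons.seg (overEdge p)

namespace LinkDiagram

variable {n : ℕ} (L : LinkDiagram n)

/-- The projection of the link: the underlying subset of the plane. -/
def projection : Set Plane := L.homeo '' L.polygons.support

/-- The crossing points of the diagram. -/
def crossings : Set Plane := L.homeo '' L.polygons.doublePoints

/-- The regions of the diagram: the connected components of the complement of the projection. -/
def regions : Set (Set Plane) :=
  {R | ∃ x ∈ L.projectionᶜ, R = connectedComponentIn L.projectionᶜ x}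

theorem finite_crossings : L.crossings.Finite :=
  L.isRegular.finite_doublePoints.image _

noncomputable instance instFintypeCrossings : Fintype L.crossings :=
  L.finite_crossings.fintype

open Classical in
/-- The incidence matrix over `ℤ/2`: rows are regions, columns are crossing points, and an entry
is `1` if the crossing point lies on the boundary of the region (also when the region touches the
crossing point from two sides) and `0` otherwise. -/
noncomputable def incidenceMatrix : Matrix L.regions L.crossings (ZMod 2) :=
  fun R c => if (c : Plane) ∈ frontier (R : Set Plane) then 1 else 0

end LinkDiagram

/-! All functions take values in ℤ/2. Consider first the variant of the incidence matrix in which a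
region is counted once for each corner it has at a crossing. Its transpose is `cornerSum`: it sends
a function `x` on the regions to the sums of `x` over the four corners at each crossing.

If such a sum vanishes, the jump of `x` across a strand is the same before and after the crossing.
The jump also passes unchanged around vertices, so it is constant along each polygon. The parity `W
i` of the winding number of the `i`-th polygon jumps across that polygon and no other. Adding a
combination of the `W i` to `x` therefore removes all jumps, and a function without jumps is
constant, because the plane minus the finitely many vertices and double points is connected. Hence
the kernel has basis 1, `W 0`, …, `W (n - 1)` (`finrank_ker_cornerSum`), and `cornerSum` has rank r
- n - 1.

The original matrix differs only at reducible crossings `c`, where one region `A` fills two opposite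
corners: `A` contributes 0 to the corner sum, but must be counted once. There a closed polygon in `A
∪ {c}` separates the other two corners. Restricting a winding parity, normalised to vanish on `A`,
to one side of that curve gives a function `w` whose corner sum is 1 at `c` and 0 at all other
crossings (`exists_cut`). So the transpose of the original matrix is `cornerSum ∘ N` with `N x = x +
∑ c, x (A c) • w c`.

It remains to see that `N` is injective. All sides carrying the `w c` are chosen to avoid a base
region `R₀`, and such a side can be entered only from `A c`. If `N x = 0`, then a walk from `R₀`
across edges shows that each `x (A c)` is already zero when the side belonging to `c` is entered, so
`x = 0` (`rank_incidence`). -/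

open Filter Topology

/-! ### Winding numbers of polygons in ℂ and their parity -/

/-- The angle, seen from `q`, between the directions of `a` and of `b`. -/
noncomputable def viewAngle (a b q : ℂ) : ℝ := Complex.arg ((b - q) / (a - q))

/-- If the quotient were a real number `-k` with `k ≥ 0`, then `q = (k a + b) / (1 + k)` would be a
convex combination of `a` and `b`. -/
theorem div_sub_mem_slitPlane {a b q : ℂ} (h : q ∉ segment ℝ a b) :
    (b - q) / (a - q) ∈ Complex.slitPlane := by
  by_contra hs
  have ha : a - q ≠ 0 := by
    intro h0
    exact h ((sub_eq_zero.mp h0) ▸ left_mem_segment ℝ a b)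
  rw [Complex.mem_slitPlane_iff] at hs
  push Not at hs
  obtain ⟨hre, him⟩ := hs
  set k : ℝ := -((b - q) / (a - q)).re with hk
  have hk0 : 0 ≤ k := by linarith
  have hr : (b - q) / (a - q) = -(k : ℂ) := by
    apply Complex.ext <;> simp [hk, him]
  rw [div_eq_iff ha] at hr
  apply h
  have hk1 : (1 + k : ℝ) ≠ 0 := by positivity
  have hk1' : (1 + (k : ℂ)) ≠ 0 := by exact_mod_cast hk1
  refine ⟨k / (1 + k), 1 / (1 + k), by positivity, by positivity, by field_simp; ring, ?_⟩
  simp only [Complex.real_smul]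
  push_cast
  field_simp
  linear_combination hr

theorem continuousAt_viewAngle {a b q : ℂ} (h : q ∉ segment ℝ a b) :
    ContinuousAt (viewAngle a b) q := by
  have ha : a - q ≠ 0 := by
    intro h0
    exact h ((sub_eq_zero.mp h0) ▸ left_mem_segment ℝ a b)
  refine (Complex.continuousAt_arg (div_sub_mem_slitPlane h)).comp (f := fun q => (b - q) / (a - q)) ?_
  exact (continuousAt_const.sub continuousAt_id).div (continuousAt_const.sub continuousAt_id) ha

/-- The winding number of the polygon `v 0, …, v m` around `q`. -/
noncomputable def windingNumber (v : ℕ → ℂ) (m : ℕ) (q : ℂ) : ℝ :=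
  (∑ j ∈ Finset.range m, viewAngle (v j) (v (j + 1)) q) / (2 * Real.pi)

/-- Modulo 2π arguments are additive, and the product of the quotients telescopes. For a closed
polygon the product is 1, so the winding number is an integer. -/
theorem coe_sum_viewAngle (v : ℕ → ℂ) (m : ℕ) (q : ℂ) (h : ∀ j, v j ≠ q) :
    ((∑ j ∈ Finset.range m, viewAngle (v j) (v (j + 1)) q : ℝ) : Real.Angle) =
      Complex.arg ((v m - q) / (v 0 - q)) := by
  have h' : ∀ j, v j - q ≠ 0 := fun j => sub_ne_zero.mpr (h j)
  induction m with
  | zero => simp [div_self (h' 0)]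
  | succ k ih =>
    rw [Finset.sum_range_succ, Real.Angle.coe_add, ih, viewAngle,
      ← Complex.arg_mul_coe_angle (div_ne_zero (h' _) (h' _)) (div_ne_zero (h' _) (h' _))]
    congr 2
    have := h' k
    field_simp

theorem exists_int_windingNumber (v : ℕ → ℂ) (m : ℕ) (q : ℂ) (h : ∀ j, v j ≠ q) (hm : v m = v 0) :
    ∃ k : ℤ, windingNumber v m q = k := by
  have h1 := coe_sum_viewAngle v m q h
  rw [hm, div_self (sub_ne_zero.mpr (h 0)), Complex.arg_one, Real.Angle.coe_zero,
    Real.Angle.coe_eq_zero_iff] at h1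
  obtain ⟨k, hk⟩ := h1
  refine ⟨k, ?_⟩
  rw [windingNumber, ← hk, zsmul_eq_mul]
  field_simp

/-- The trace of the polygon `v 0, …, v m`. -/
def polygonTrace (v : ℕ → ℂ) (m : ℕ) : Set ℂ := {q | ∃ j < m, q ∈ segment ℝ (v j) (v (j + 1))}

theorem continuousAt_windingNumber {v : ℕ → ℂ} {m : ℕ} {q : ℂ} (h : q ∉ polygonTrace v m) :
    ContinuousAt (windingNumber v m) q := by
  unfold windingNumber
  refine ContinuousAt.div_const ?_ _
  refine tendsto_finsetSum _ fun j hj => ?_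
  exact continuousAt_viewAngle fun hq => h ⟨j, Finset.mem_range.mp hj, hq⟩

/-- The parity of the winding number. -/
noncomputable def windingParity (v : ℕ → ℂ) (m : ℕ) (q : ℂ) : ZMod 2 :=
  ((round (windingNumber v m q) : ℤ) : ZMod 2)

theorem isClosed_polygonTrace (v : ℕ → ℂ) (m : ℕ) : IsClosed (polygonTrace v m) := by
  have : polygonTrace v m = ⋃ j ∈ Finset.range m, segment ℝ (v j) (v (j + 1)) := by
    ext; simp [polygonTrace]
  rw [this]
  refine Set.Finite.isClosed_biUnion (Finset.finite_toSet _) fun j _ => ?_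
  rw [segment_eq_image]
  exact (isCompact_Icc.image (by fun_prop)).isClosed

theorem eventually_windingParity_eq {v : ℕ → ℂ} {m : ℕ} {q : ℂ} (hv : ∀ j, ∃ k < m, v j = v k)
    (hm : v m = v 0) (h : q ∉ polygonTrace v m) :
    ∀ᶠ q' in 𝓝 q, windingParity v m q' = windingParity v m q := by
  -- The sequence `v` runs over all of ℕ; `hv` says that the terms beyond the polygon repeat its
  -- vertices.
  have hne : ∀ q, q ∉ polygonTrace v m → ∀ j, v j ≠ q := by
    rintro q hq j rfl
    obtain ⟨k, hk, hjk⟩ := hv j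
    exact hq ⟨k, hk, hjk ▸ left_mem_segment ℝ _ _⟩
  have h1 : ∀ᶠ q' in 𝓝 q, q' ∉ polygonTrace v m :=
    (isClosed_polygonTrace v m).isOpen_compl.mem_nhds h
  have h2 := (Metric.continuousAt_iff'.mp (continuousAt_windingNumber h)) 1 one_pos
  filter_upwards [h1, h2] with q' hq' hd
  obtain ⟨k, hk⟩ := exists_int_windingNumber v m q (hne q h) hm
  obtain ⟨l, hl⟩ := exists_int_windingNumber v m q' (hne q' hq') hm
  rw [windingParity, windingParity, hk, hl]
  rw [hk, hl, Real.dist_eq] at hd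
  have : |l - k| < 1 := by exact_mod_cast hd
  rw [Int.abs_lt_one_iff, sub_eq_zero] at this
  rw [this]

/-- At the point with parameters `s`, `t` the quotient is `1 - 1 / (s + tν)`. It tends to the
negative real number `1 - 1 / s`, with imaginary part of the sign of `t`, so it reaches the cut of
`arg` from above for `t > 0` and from below for `t < 0`. -/
theorem tendsto_viewAngle {a b ν : ℂ} {s : ℝ} (hab : a ≠ b) (hs0 : 0 < s) (hs1 : s < 1)
    (hν : 0 < ν.im) :
    Tendsto (fun t : ℝ => viewAngle a b (a + s * (b - a) + t * (ν * (b - a)))) (𝓝[>] 0)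
      (𝓝 Real.pi) ∧
    Tendsto (fun t : ℝ => viewAngle a b (a + s * (b - a) - t * (ν * (b - a)))) (𝓝[>] 0)
      (𝓝 (-Real.pi)) := by
  have hd : b - a ≠ 0 := sub_ne_zero.mpr hab.symm
  set z : ℂ := ((1 - 1 / s : ℝ) : ℂ) with hz
  have hre : z.re < 0 := by
    rw [hz, Complex.ofReal_re, sub_neg, lt_div_iff₀ hs0]; linarith
  have him : z.im = 0 := Complex.ofReal_im _
  have hnz : ∀ t : ℝ, t ≠ 0 → (s + t * ν : ℂ) ≠ 0 := by
    intro t ht h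
    have := congrArg Complex.im h
    simp [ht, hν.ne'] at this
  have hr : ∀ t : ℝ, t ≠ 0 → (b - (a + s * (b - a) + t * (ν * (b - a)))) /
      (a - (a + s * (b - a) + t * (ν * (b - a)))) = 1 - 1 / (s + t * ν) := by
    intro t ht
    have h1 := hnz t ht
    have h2 : a - (a + s * (b - a) + t * (ν * (b - a))) = -((s + t * ν) * (b - a)) := by ring
    have h3 : -((s + t * ν) * (b - a)) ≠ 0 := neg_ne_zero.mpr (mul_ne_zero h1 hd)
    rw [h2, div_eq_iff h3]
    field_simp
    ring
  have hcont : Tendsto (fun t : ℝ => 1 - 1 / (s + t * ν : ℂ)) (𝓝 0) (𝓝 z) := by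
    have : ContinuousAt (fun t : ℝ => 1 - 1 / (s + t * ν : ℂ)) 0 := by
      refine ContinuousAt.sub continuousAt_const (ContinuousAt.div continuousAt_const ?_ ?_)
      · fun_prop
      · simp [hs0.ne']
    simpa [ContinuousAt, hz] using this
  have himt : ∀ t : ℝ, t ≠ 0 → (1 - 1 / (s + t * ν : ℂ)).im =
      t * ν.im / Complex.normSq (s + t * ν) := by
    intro t _
    simp [Complex.inv_im, neg_div]
  have hpos : ∀ t : ℝ, t ≠ 0 → 0 < Complex.normSq (s + t * ν) := fun t ht =>
    Complex.normSq_pos.mpr (hnz t ht)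
  constructor
  · have h1 : Tendsto (fun t : ℝ => 1 - 1 / (s + t * ν : ℂ)) (𝓝[>] 0)
        (𝓝[{w : ℂ | 0 ≤ w.im}] z) := by
      refine tendsto_nhdsWithin_iff.mpr ⟨hcont.mono_left nhdsWithin_le_nhds, ?_⟩
      filter_upwards [self_mem_nhdsWithin] with t (ht : 0 < t)
      rw [himt t ht.ne']
      have := hpos t ht.ne'
      positivity
    refine ((Complex.tendsto_arg_nhdsWithin_im_nonneg_of_re_neg_of_im_zero hre him).comp h1).congr' ?_
    filter_upwards [self_mem_nhdsWithin] with t (ht : 0 < t)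
    rw [Function.comp_apply, viewAngle, hr t ht.ne']
  · have h0 : Tendsto (fun t : ℝ => -t) (𝓝[>] 0) (𝓝 0) := by
      have : Tendsto (fun t : ℝ => -t) (𝓝 0) (𝓝 0) := by simpa using (continuous_neg (G := ℝ)).tendsto 0
      exact this.mono_left nhdsWithin_le_nhds
    have h1 : Tendsto (fun t : ℝ => 1 - 1 / (s + ((-t : ℝ) : ℂ) * ν : ℂ)) (𝓝[>] 0)
        (𝓝[{w : ℂ | w.im < 0}] z) := by
      refine tendsto_nhdsWithin_iff.mpr ⟨hcont.comp h0, ?_⟩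
      filter_upwards [self_mem_nhdsWithin] with t (ht : 0 < t)
      rw [himt (-t) (neg_ne_zero.mpr ht.ne')]
      have := hpos (-t) (neg_ne_zero.mpr ht.ne')
      exact div_neg_of_neg_of_pos (by nlinarith) this
    refine ((Complex.tendsto_arg_nhdsWithin_im_neg_of_re_neg_of_im_zero hre him).comp h1).congr' ?_
    filter_upwards [self_mem_nhdsWithin] with t (ht : 0 < t)
    have h2 := hr (-t) (neg_ne_zero.mpr ht.ne')
    rw [Function.comp_apply, viewAngle, ← h2]
    congr 2 <;> · push_cast; ring

/-- Only the angle of the edge `i` is discontinuous at the point, and it jumps by 2π. The difference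
of the two winding numbers is an integer tending to 1, hence eventually equal to 1. -/
theorem windingParity_jump_of_pos {v : ℕ → ℂ} {m i : ℕ} {ν : ℂ} {s : ℝ}
    (hm : v m = v 0) (hi : i < m) (hab : v i ≠ v (i + 1)) (hs0 : 0 < s) (hs1 : s < 1)
    (hν : 0 < ν.im)
    (h : ∀ j < m, v i + s * (v (i + 1) - v i) ∈ segment ℝ (v j) (v (j + 1)) → j = i)
    (hv : ∀ j, ∃ k < m, v j = v k) :
    ∀ᶠ t : ℝ in 𝓝[>] 0,
      windingParity v m (v i + s * (v (i + 1) - v i) + t * (ν * (v (i + 1) - v i))) ≠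
      windingParity v m (v i + s * (v (i + 1) - v i) - t * (ν * (v (i + 1) - v i))) := by
  set d := v (i + 1) - v i with hd
  set p := v i + s * d with hp
  have hd0 : d ≠ 0 := sub_ne_zero.mpr hab.symm
  have hvp : ∀ j, v j ≠ p := by
    intro j hj
    obtain ⟨k, hk, hjk⟩ := hv j
    have hki := h k hk (by rw [← hj, hjk]; exact left_mem_segment ℝ _ _)
    rw [hjk, hki, hp] at hj
    have : (s : ℂ) * d = 0 := by linear_combination -hj
    simp [hs0.ne', hd0] at this
  have hplus : Tendsto (fun t : ℝ => p + t * (ν * d)) (𝓝[>] 0) (𝓝 p) := by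
    have : ContinuousAt (fun t : ℝ => p + t * (ν * d)) 0 := by fun_prop
    have h2 : Tendsto (fun t : ℝ => p + t * (ν * d)) (𝓝 0) (𝓝 p) := by
      simpa [ContinuousAt] using this
    exact h2.mono_left nhdsWithin_le_nhds
  have hminus : Tendsto (fun t : ℝ => p - t * (ν * d)) (𝓝[>] 0) (𝓝 p) := by
    have : ContinuousAt (fun t : ℝ => p - t * (ν * d)) 0 := by fun_prop
    have h2 : Tendsto (fun t : ℝ => p - t * (ν * d)) (𝓝 0) (𝓝 p) := by
      simpa [ContinuousAt] using this
    exact h2.mono_left nhdsWithin_le_nhds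
  have hnear : ∀ᶠ q in 𝓝 p, ∀ j, v j ≠ q := by
    have : ∀ᶠ q in 𝓝 p, ∀ j ∈ Finset.range m, v j ≠ q := by
      rw [Finset.eventually_all]
      exact fun j _ => (isOpen_compl_singleton.eventually_mem (hvp j).symm).mono fun q hq => Ne.symm hq
    filter_upwards [this] with q hq j
    obtain ⟨k, hk, hjk⟩ := hv j
    rw [hjk]
    exact hq k (Finset.mem_range.mpr hk)
  have hdiff : Tendsto (fun t : ℝ => windingNumber v m (p + t * (ν * d)) -
      windingNumber v m (p - t * (ν * d))) (𝓝[>] 0) (𝓝 1) := by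
    have hterm : ∀ j ∈ Finset.range m, Tendsto (fun t : ℝ =>
        viewAngle (v j) (v (j + 1)) (p + t * (ν * d)) -
          viewAngle (v j) (v (j + 1)) (p - t * (ν * d))) (𝓝[>] 0)
        (𝓝 (if j = i then 2 * Real.pi else 0)) := by
      intro j hj
      split_ifs with hji
      · subst hji
        have := tendsto_viewAngle hab hs0 hs1 hν
        have h3 := this.1.sub this.2
        rwa [show Real.pi - -Real.pi = 2 * Real.pi by ring] at h3
      · have hc : ContinuousAt (viewAngle (v j) (v (j + 1))) p :=
          continuousAt_viewAngle fun hq => hji (h j (Finset.mem_range.mp hj) hq)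
        simpa using (hc.tendsto.comp hplus).sub (hc.tendsto.comp hminus)
    have hsum := (tendsto_finsetSum _ hterm).div_const (2 * Real.pi)
    rw [Finset.sum_ite_eq' , if_pos (Finset.mem_range.mpr hi), div_self (by positivity)] at hsum
    refine hsum.congr fun t => ?_
    rw [windingNumber, windingNumber, Finset.sum_sub_distrib, sub_div]
  have hclose := (Metric.tendsto_nhds.mp hdiff) 1 one_pos
  filter_upwards [hclose, hplus.eventually hnear, hminus.eventually hnear] with t ht h1 h2
  obtain ⟨k, hk⟩ := exists_int_windingNumber v m _ h1 hm
  obtain ⟨l, hl⟩ := exists_int_windingNumber v m _ h2 hm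
  rw [windingParity, windingParity, hk, hl, round_intCast, round_intCast]
  rw [hk, hl, Real.dist_eq] at ht
  have h3 : |k - l - 1| < 1 := by exact_mod_cast ht
  rw [Int.abs_lt_one_iff] at h3
  have h4 : k = l + 1 := by omega
  rw [h4]
  push_cast
  generalize (l : ZMod 2) = x
  revert x
  decide

theorem windingParity_jump {v : ℕ → ℂ} {m i : ℕ} {ν : ℂ} {s : ℝ}
    (hm : v m = v 0) (hi : i < m) (hab : v i ≠ v (i + 1)) (hs0 : 0 < s) (hs1 : s < 1)
    (hν : ν.im ≠ 0)
    (h : ∀ j < m, v i + s * (v (i + 1) - v i) ∈ segment ℝ (v j) (v (j + 1)) → j = i)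
    (hv : ∀ j, ∃ k < m, v j = v k) :
    ∀ᶠ t : ℝ in 𝓝[>] 0,
      windingParity v m (v i + s * (v (i + 1) - v i) + t * (ν * (v (i + 1) - v i))) ≠
      windingParity v m (v i + s * (v (i + 1) - v i) - t * (ν * (v (i + 1) - v i))) := by
  rcases lt_or_gt_of_ne hν with hneg | hpos
  · have := windingParity_jump_of_pos (ν := -ν) hm hi hab hs0 hs1 (by simpa using hneg) h hv
    filter_upwards [this] with t ht
    convert ht.symm using 2 <;> ring
  · exact windingParity_jump_of_pos hm hi hab hs0 hs1 hpos h hv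

/-! ### Transfer to the Euclidean plane; affine charts -/

/-- The identification of the plane with the complex numbers. -/
noncomputable def planeToComplex : Plane ≃ₗᵢ[ℝ] ℂ := Complex.orthonormalBasisOneI.repr.symm

theorem planeToComplex_apply (q : Plane) : planeToComplex q = ⟨q 0, q 1⟩ := by
  have := (Complex.orthonormalBasisOneI.sum_repr_symm q)
  rw [planeToComplex, ← this]
  simp [Fin.sum_univ_two]
  apply Complex.ext <;> simp

/-- The signed area of the parallelogram spanned by two vectors. -/
def cross (u w : Plane) : ℝ := u 0 * w 1 - u 1 * w 0

theorem planeToComplex_mem_segment {a b q : Plane} :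
    planeToComplex q ∈ segment ℝ (planeToComplex a) (planeToComplex b) ↔ q ∈ segment ℝ a b := by
  have h := image_segment ℝ planeToComplex.toLinearEquiv.toLinearMap.toAffineMap a b
  have h' : planeToComplex '' segment ℝ a b =
      segment ℝ (planeToComplex a) (planeToComplex b) := by simpa using h
  rw [← h', planeToComplex.injective.mem_set_image]

/-- The parity of the winding number of a polygon in the plane. -/
noncomputable def planeParity (V : ℕ → Plane) (m : ℕ) (q : Plane) : ZMod 2 :=
  windingParity (fun j => planeToComplex (V j)) m (planeToComplex q)

theorem eventually_planeParity_eq {V : ℕ → Plane} {m : ℕ} {q : Plane}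
    (hV : ∀ j, ∃ k < m, V j = V k) (hm : V m = V 0)
    (h : ∀ j < m, q ∉ segment ℝ (V j) (V (j + 1))) :
    ∀ᶠ q' in 𝓝 q, planeParity V m q' = planeParity V m q := by
  refine planeToComplex.continuous.continuousAt.eventually
    (eventually_windingParity_eq (v := fun j => planeToComplex (V j)) (m := m) ?_ ?_ ?_)
  · intro j
    obtain ⟨k, hk, h⟩ := hV j
    exact ⟨k, hk, by rw [h]⟩
  · simp only [hm]
  · rintro ⟨j, hj, hq⟩
    exact h j hj (planeToComplex_mem_segment.mp hq)

theorem planeParity_jump {V : ℕ → Plane} {m i : ℕ} {w : Plane} {s : ℝ}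
    (hV : ∀ j, ∃ k < m, V j = V k) (hm : V m = V 0) (hi : i < m) (hs0 : 0 < s) (hs1 : s < 1)
    (hw : cross (V (i + 1) - V i) w ≠ 0)
    (h : ∀ j < m, V i + s • (V (i + 1) - V i) ∈ segment ℝ (V j) (V (j + 1)) → j = i) :
    ∀ᶠ t : ℝ in 𝓝[>] 0, planeParity V m (V i + s • (V (i + 1) - V i) + t • w) ≠
      planeParity V m (V i + s • (V (i + 1) - V i) - t • w) := by
  have hab : V i ≠ V (i + 1) := by
    intro h0
    simp [h0, cross] at hw
  have hd : planeToComplex (V (i + 1)) - planeToComplex (V i) ≠ 0 :=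
    sub_ne_zero.mpr (planeToComplex.injective.ne hab.symm)
  -- With `d` the direction of the edge, the imaginary part of `w / d` is `cross d w / |d|²`.
  have hν : (planeToComplex w / (planeToComplex (V (i + 1)) - planeToComplex (V i))).im ≠ 0 := by
    have hn := Complex.normSq_pos.mpr hd
    rw [Complex.div_im, ← sub_div]
    refine div_ne_zero ?_ hn.ne'
    rw [← map_sub, planeToComplex_apply, planeToComplex_apply]
    simp only [cross] at hw
    intro h0
    apply hw
    linear_combination h0
  have key := windingParity_jump (v := fun j => planeToComplex (V j)) (m := m) (i := i)
    (by simp only [hm]) hi (planeToComplex.injective.ne hab) hs0 hs1 hν ?_ ?_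
  · filter_upwards [key] with t ht
    simp only [planeParity, map_add, map_sub, map_smul, Complex.real_smul] at ht ⊢
    rwa [div_mul_cancel₀ _ hd] at ht
  · intro j hj hq
    apply h j hj
    rw [← planeToComplex_mem_segment]
    simpa only [map_add, map_sub, map_smul, Complex.real_smul] using hq
  · intro j
    obtain ⟨k, hk, h⟩ := hV j
    exact ⟨k, hk, by rw [h]⟩

theorem exists_smul_of_cross_eq_zero {u w : Plane} (hu : u ≠ 0) (h : cross u w = 0) :
    ∃ r : ℝ, w = r • u := by
  have hpos : u 0 * u 0 + u 1 * u 1 ≠ 0 := by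
    intro h0
    apply hu
    have h1 : u 0 = 0 := by nlinarith [mul_self_nonneg (u 0), mul_self_nonneg (u 1)]
    have h2 : u 1 = 0 := by nlinarith [mul_self_nonneg (u 0), mul_self_nonneg (u 1)]
    ext i
    fin_cases i <;> simp [h1, h2]
  rw [cross] at h
  have hK := mul_inv_cancel₀ hpos
  refine ⟨(u 0 * w 0 + u 1 * w 1) / (u 0 * u 0 + u 1 * u 1), ?_⟩
  ext i
  fin_cases i
  · simp
    linear_combination (-w 0) * hK - u 1 * (u 0 * u 0 + u 1 * u 1)⁻¹ * h
  · simp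
    linear_combination (-w 1) * hK + u 0 * (u 0 * u 0 + u 1 * u 1)⁻¹ * h

theorem exists_cross_ne_zero {u : Plane} (hu : u ≠ 0) : ∃ w, cross u w ≠ 0 := by
  -- The witness is `u` turned by a right angle.
  refine ⟨!₂[-u 1, u 0], ?_⟩
  intro h0
  simp [cross] at h0
  apply hu
  have h1 : u 0 = 0 := by nlinarith [mul_self_nonneg (u 0), mul_self_nonneg (u 1)]
  have h2 : u 1 = 0 := by nlinarith [mul_self_nonneg (u 0), mul_self_nonneg (u 1)]
  ext i
  fin_cases i <;> simp [h1, h2]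

/-- Affine coordinates of the plane with origin `p` and basis `u`, `v`. -/
noncomputable def planeChart (p u v : Plane) (h : cross u v ≠ 0) : ℝ × ℝ ≃ₜ Plane where
  toFun x := p + x.1 • u + x.2 • v
  -- Cramer's rule.
  invFun q := (cross (q - p) v / cross u v, cross u (q - p) / cross u v)
  left_inv x := by
    have hK := mul_inv_cancel₀ h
    rw [cross] at hK
    ext <;> simp [cross]
    · linear_combination x.1 * hK
    · linear_combination x.2 * hK
  right_inv q := by
    have hK := mul_inv_cancel₀ h
    rw [cross] at hK
    ext i
    fin_cases i <;> simp [cross]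
    · linear_combination (q 0 - p 0) * hK
    · linear_combination (q 1 - p 1) * hK
  continuous_toFun := by fun_prop
  continuous_invFun := by
    unfold cross
    fun_prop

theorem exists_box_of_eventually {p u v : Plane} {T : Plane → Prop} (h : ∀ᶠ q in 𝓝 p, T q) :
    ∃ δ > 0, ∀ a b : ℝ, |a| < δ → |b| < δ → T (p + a • u + b • v) := by
  have hc : ContinuousAt (fun x : ℝ × ℝ => p + x.1 • u + x.2 • v) (0, 0) := by fun_prop
  have h1 : ∀ᶠ x : ℝ × ℝ in 𝓝 (0, 0), T (p + x.1 • u + x.2 • v) :=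
    hc.eventually (by simpa using h)
  obtain ⟨δ, hδ, hT⟩ := Metric.eventually_nhds_iff.mp h1
  refine ⟨δ, hδ, fun a b ha hb => hT (y := (a, b)) ?_⟩
  simp [Prod.dist_eq, ha, hb]

theorem eventually_of_box {p u v : Plane} {T : Plane → Prop} (huv : cross u v ≠ 0) {δ : ℝ}
    (hδ : 0 < δ) (h : ∀ a b : ℝ, |a| < δ → |b| < δ → T (p + a • u + b • v)) :
    ∀ᶠ q in 𝓝 p, T q := by
  have h1 : ∀ᶠ x : ℝ × ℝ in 𝓝 (0, 0), T (planeChart p u v huv x) := by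
    refine Metric.eventually_nhds_iff.mpr ⟨δ, hδ, fun x hx => ?_⟩
    rw [Prod.dist_eq, max_lt_iff] at hx
    exact h _ _ (by simpa using hx.1) (by simpa using hx.2)
  have h2 := Filter.eventually_map.mpr h1
  rw [(planeChart p u v huv).map_nhds_eq] at h2
  simpa [planeChart] using h2

theorem chart_mem_segment_iff {x y v : Plane} (h : cross (y - x) v ≠ 0) (a b : ℝ) :
    x + a • (y - x) + b • v ∈ segment ℝ x y ↔ b = 0 ∧ 0 ≤ a ∧ a ≤ 1 := by
  rw [segment_eq_image']
  constructor
  · rintro ⟨t, ⟨ht0, ht1⟩, ht⟩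
    have := (planeChart x (y - x) v h).injective (a₁ := (t, 0)) (a₂ := (a, b))
      (by simpa [planeChart] using ht)
    obtain ⟨rfl, rfl⟩ := Prod.ext_iff.mp this
    exact ⟨rfl, ht0, ht1⟩
  · rintro ⟨rfl, h0, h1⟩
    exact ⟨a, ⟨h0, h1⟩, by simp⟩

/-! ### Regions, and the local models: line, angle and two crossing lines -/

namespace PolygonSystem

variable {n : ℕ} (P : PolygonSystem n)

/-- The regions: connected components of the complement of the polygons. -/
abbrev Region : Type :=
  {R : Set Plane // ∃ x ∈ P.supportᶜ, R = connectedComponentIn P.supportᶜ x}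

instance instFiniteEdge : Finite P.Edge := by
  have hfin : ∀ i, Finite (ZMod (P.size i)) := fun i => inferInstance
  exact inferInstanceAs (Finite (Σ i : Fin n, ZMod (P.size i)))

theorem isCompact_seg (e : P.Edge) : IsCompact (P.seg e) := by
  rw [seg, segment_eq_image]
  exact isCompact_Icc.image (by fun_prop)

theorem isCompact_support : IsCompact P.support := isCompact_iUnion P.isCompact_seg

theorem isOpen_compl_support : IsOpen P.supportᶜ := P.isCompact_support.isClosed.isOpen_compl

theorem eventually_mem_seg (p : Plane) : ∀ᶠ q in 𝓝 p, ∀ f, q ∈ P.seg f → p ∈ P.seg f := by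
  rw [eventually_all]
  intro f
  by_cases h : p ∈ P.seg f
  · exact Eventually.of_forall fun _ _ => h
  · exact ((P.isCompact_seg f).isClosed.isOpen_compl.eventually_mem h).mono
      fun q hq hq' => absurd hq' hq

variable {P}

theorem mem_support {q : Plane} : q ∈ P.support ↔ ∃ e, q ∈ P.seg e := Set.mem_iUnion

namespace Region

theorem isOpen (R : P.Region) : IsOpen R.1 := by
  obtain ⟨_, x, hx, rfl⟩ := R
  exact P.isOpen_compl_support.connectedComponentIn

theorem isPreconnected (R : P.Region) : IsPreconnected R.1 := by
  obtain ⟨_, x, hx, rfl⟩ := R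
  exact isPreconnected_connectedComponentIn

theorem nonempty (R : P.Region) : R.1.Nonempty := by
  obtain ⟨_, x, hx, rfl⟩ := R
  exact ⟨x, mem_connectedComponentIn hx⟩

theorem notMem_support {R : P.Region} {q : Plane} (h : q ∈ R.1) : q ∉ P.support := by
  obtain ⟨_, x, hx, rfl⟩ := R
  exact connectedComponentIn_subset _ _ h

theorem exists_subset {C : Set Plane} (hC : IsPreconnected C) (hne : C.Nonempty)
    (h : ∀ q ∈ C, q ∉ P.support) : ∃ R : P.Region, C ⊆ R.1 := by
  obtain ⟨x, hx⟩ := hne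
  exact ⟨⟨_, x, h x hx, rfl⟩, hC.subset_connectedComponentIn hx h⟩

theorem exists_mem {q : Plane} (h : q ∉ P.support) : ∃ R : P.Region, q ∈ R.1 :=
  ⟨⟨_, q, h, rfl⟩, mem_connectedComponentIn h⟩

theorem eq_of_mem {R S : P.Region} {q : Plane} (hR : q ∈ R.1) (hS : q ∈ S.1) : R = S := by
  obtain ⟨_, x, hx, rfl⟩ := R
  obtain ⟨_, y, hy, rfl⟩ := S
  exact Subtype.ext ((connectedComponentIn_eq hR).trans (connectedComponentIn_eq hS).symm)

theorem mem_of_mem_closure {R : P.Region} {q : Plane} (h : q ∉ P.support)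
    (hq : q ∈ closure R.1) : q ∈ R.1 := by
  obtain ⟨S, hS⟩ := exists_mem h
  obtain ⟨x, hxS, hxR⟩ := mem_closure_iff.mp hq S.1 S.isOpen hS
  rwa [eq_of_mem hxR hxS]

end Region

variable (P) in
/-- Near `p`, the complement of the polygons consists of parts of `Q` and of `Q'`. -/
def Sides (p : Plane) (Q Q' : P.Region) : Prop :=
  p ∈ closure Q.1 ∧ p ∈ closure Q'.1 ∧ ∀ᶠ q in 𝓝 p, q ∈ P.support ∨ q ∈ Q.1 ∨ q ∈ Q'.1

theorem Sides.symm {p : Plane} {Q Q' : P.Region} (h : P.Sides p Q Q') : P.Sides p Q' Q :=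
  ⟨h.2.1, h.1, h.2.2.mono fun _ hq => hq.imp_right Or.symm⟩

theorem Sides.eq_or_eq {p : Plane} {Q Q' T : P.Region} (h : P.Sides p Q Q')
    (hT : p ∈ closure T.1) : T = Q ∨ T = Q' := by
  obtain ⟨x, hxT, hx⟩ := (mem_closure_iff_frequently.mp hT).and_eventually h.2.2 |>.exists
  rcases hx with hx | hx | hx
  · exact absurd hx (Region.notMem_support hxT)
  · exact Or.inl (Region.eq_of_mem hxT hx)
  · exact Or.inr (Region.eq_of_mem hxT hx)

/-- `Q` and `Q'` are exactly the regions with `p` in their closure, so the unordered pair is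
determined. The case `Q = Q'` is allowed. -/
theorem Sides.unique {p : Plane} {Q Q' T T' : P.Region} (h : P.Sides p Q Q')
    (h' : P.Sides p T T') : (Q = T ∧ Q' = T') ∨ (Q = T' ∧ Q' = T) := by
  have h1 := h.eq_or_eq h'.1
  have h2 := h.eq_or_eq h'.2.1
  have h3 := h'.eq_or_eq h.1
  have h4 := h'.eq_or_eq h.2.1
  grind

theorem exists_region_of_chart (p u v : Plane) {S : Set (ℝ × ℝ)} (hS : IsPreconnected S)
    (hne : S.Nonempty) (h : ∀ x ∈ S, p + x.1 • u + x.2 • v ∉ P.support) :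
    ∃ R : P.Region, ∀ a b, (a, b) ∈ S → p + a • u + b • v ∈ R.1 := by
  obtain ⟨R, hR⟩ := Region.exists_subset (P := P)
    (hS.image (fun x : ℝ × ℝ => p + x.1 • u + x.2 • v) (by fun_prop)) (hne.image _)
    (by rintro _ ⟨x, hx, rfl⟩; exact h x hx)
  exact ⟨R, fun a b hab => hR ⟨(a, b), hab, rfl⟩⟩

theorem mem_closure_of_ray {p w : Plane} {S : Set Plane}
    (h : ∀ᶠ t : ℝ in 𝓝[>] 0, p + t • w ∈ S) : p ∈ closure S := by
  have hc : Tendsto (fun t : ℝ => p + t • w) (𝓝[>] 0) (𝓝 p) := by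
    have : ContinuousAt (fun t : ℝ => p + t • w) 0 := by fun_prop
    have h2 : Tendsto (fun t : ℝ => p + t • w) (𝓝 0) (𝓝 p) := by
      simpa [ContinuousAt] using this
    exact h2.mono_left nhdsWithin_le_nhds
  exact mem_closure_of_tendsto hc h

theorem eventually_pos_lt {δ : ℝ} (hδ : 0 < δ) : ∀ᶠ t : ℝ in 𝓝[>] 0, 0 < t ∧ t < δ :=
  Ioo_mem_nhdsGT hδ

theorem sides_of_box {p u v : Plane} {δ : ℝ} {Q Q' : P.Region} (huv : cross u v ≠ 0) (hδ : 0 < δ)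
    (hup : ∀ a b : ℝ, |a| < δ → 0 < b → b < δ → p + a • u + b • v ∈ Q.1)
    (hdown : ∀ a b : ℝ, |a| < δ → -δ < b → b < 0 → p + a • u + b • v ∈ Q'.1)
    (hmid : ∀ a : ℝ, |a| < δ → p + a • u ∈ P.support) : P.Sides p Q Q' := by
  refine ⟨mem_closure_of_ray (w := v) ?_, mem_closure_of_ray (w := -v) ?_,
    eventually_of_box huv hδ ?_⟩
  · filter_upwards [eventually_pos_lt hδ] with t ht
    simpa using hup 0 t (by simpa using hδ) ht.1 ht.2
  · filter_upwards [eventually_pos_lt hδ] with t ht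
    simpa using hdown 0 (-t) (by simpa using hδ) (by linarith) (by linarith)
  · intro a b ha hb
    rw [abs_lt] at hb
    rcases lt_trichotomy b 0 with h | rfl | h
    · exact Or.inr (Or.inr (hdown a b ha hb.1 h))
    · left; simpa using hmid a ha
    · exact Or.inr (Or.inl (hup a b ha h hb.2))

/-- Two regions that lie on the two sides of the first coordinate axis, in a box over `(α, β)`. -/
theorem sides_of_strip {p u v : Plane} {α β δ a₀ : ℝ} {Q Q' : P.Region} (huv : cross u v ≠ 0)
    (hδ : 0 < δ) (hα : α < a₀) (hβ : a₀ < β)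
    (hup : ∀ a b : ℝ, α < a → a < β → 0 < b → b < δ → p + a • u + b • v ∈ Q.1)
    (hdown : ∀ a b : ℝ, α < a → a < β → -δ < b → b < 0 → p + a • u + b • v ∈ Q'.1)
    (hmid : ∀ a : ℝ, α < a → a < β → p + a • u ∈ P.support) : P.Sides (p + a₀ • u) Q Q' := by
  set η := min δ (min (a₀ - α) (β - a₀)) with hη
  have h1 : η ≤ δ := min_le_left _ _
  have h2 : η ≤ a₀ - α := (min_le_right _ _).trans (min_le_left _ _)
  have h3 : η ≤ β - a₀ := (min_le_right _ _).trans (min_le_right _ _)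
  have hη0 : 0 < η := lt_min hδ (lt_min (by linarith) (by linarith))
  have e1 : ∀ a b : ℝ, p + a₀ • u + a • u + b • v = p + (a₀ + a) • u + b • v := by
    intros; module
  have e2 : ∀ a : ℝ, p + a₀ • u + a • u = p + (a₀ + a) • u := by intros; module
  refine sides_of_box huv hη0 ?_ ?_ ?_
  · intro a b ha hb hb'
    rw [abs_lt] at ha
    rw [e1]
    exact hup _ _ (by linarith) (by linarith) hb (by linarith)
  · intro a b ha hb hb'
    rw [abs_lt] at ha
    rw [e1]
    exact hdown _ _ (by linarith) (by linarith) (by linarith) hb'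
  · intro a ha
    rw [abs_lt] at ha
    rw [e2]
    exact hmid _ (by linarith) (by linarith)

/-- If the polygons look like a line near `p`, then there are two regions near `p`. -/
theorem exists_sides_of_line {p u v : Plane} (huv : cross u v ≠ 0) {δ : ℝ} (hδ : 0 < δ)
    (h : ∀ a b : ℝ, |a| < δ → |b| < δ → (p + a • u + b • v ∈ P.support ↔ b = 0)) :
    ∃ Q Q' : P.Region, (∀ᶠ t : ℝ in 𝓝[>] 0, p + t • v ∈ Q.1 ∧ p - t • v ∈ Q'.1) ∧
      (∀ a, |a| < δ → P.Sides (p + a • u) Q Q') := by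
  obtain ⟨Q, hQ⟩ := exists_region_of_chart (P := P) p u v (S := Set.Ioo (-δ) δ ×ˢ Set.Ioo 0 δ)
    ((convex_Ioo _ _).prod (convex_Ioo _ _)).isPreconnected
    ⟨(0, δ / 2), ⟨by constructor <;> simp [hδ], by constructor <;> simp [hδ]⟩⟩
    (by
      rintro ⟨a, b⟩ ⟨ha, hb⟩
      simp only [Set.mem_Ioo] at ha hb
      rw [h a b (abs_lt.mpr ha) (abs_lt.mpr ⟨by linarith, hb.2⟩)]
      exact hb.1.ne')
  obtain ⟨Q', hQ'⟩ := exists_region_of_chart (P := P) p u v (S := Set.Ioo (-δ) δ ×ˢ Set.Ioo (-δ) 0)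
    ((convex_Ioo _ _).prod (convex_Ioo _ _)).isPreconnected
    ⟨(0, -(δ / 2)), ⟨by constructor <;> simp [hδ], by constructor <;> simp [hδ]⟩⟩
    (by
      rintro ⟨a, b⟩ ⟨ha, hb⟩
      simp only [Set.mem_Ioo] at ha hb
      rw [h a b (abs_lt.mpr ha) (abs_lt.mpr ⟨hb.1, by linarith⟩)]
      exact hb.2.ne)
  refine ⟨Q, Q', ?_, ?_⟩
  · filter_upwards [eventually_pos_lt hδ] with t ht
    constructor
    · simpa using hQ 0 t ⟨by simp [hδ], ht⟩
    · have := hQ' 0 (-t) ⟨by simp [hδ], by constructor <;> simp <;> linarith⟩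
      simpa [sub_eq_add_neg] using this
  · intro a ha
    rw [abs_lt] at ha
    refine sides_of_strip huv hδ ha.1 ha.2 ?_ ?_ ?_
    · exact fun a b h1 h2 h3 h4 => hQ a b ⟨⟨h1, h2⟩, ⟨h3, h4⟩⟩
    · exact fun a b h1 h2 h3 h4 => hQ' a b ⟨⟨h1, h2⟩, ⟨h3, h4⟩⟩
    · intro a h1 h2
      have := (h a 0 (abs_lt.mpr ⟨h1, h2⟩) (by simpa using hδ)).mpr rfl
      simpa using this

/-- If the polygons look like two transverse lines near `c`, then there are four corners at `c`. -/
structure IsCorners (P : PolygonSystem n) (c u v : Plane) (A B C D : P.Region) : Prop where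
  cross_ne : cross u v ≠ 0
  eventually_mem : ∀ᶠ q in 𝓝 c, q ∈ P.support ∨ q ∈ A.1 ∨ q ∈ B.1 ∨ q ∈ C.1 ∨ q ∈ D.1
  ray : ∀ᶠ t : ℝ in 𝓝[>] 0, c + t • (u + v) ∈ A.1 ∧ c + t • (u - v) ∈ B.1 ∧
    c - t • (u + v) ∈ C.1 ∧ c - t • (u - v) ∈ D.1
  sides : ∀ᶠ t : ℝ in 𝓝[>] 0, P.Sides (c + t • u) A B ∧ P.Sides (c - t • u) D C ∧
    P.Sides (c + t • v) A D ∧ P.Sides (c - t • v) B C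

/-- Each open quadrant of the box is connected and misses the polygons, so it lies in one region.
`A`, `B`, `C`, `D` belong to the sign patterns (+,+), (+,-), (-,-), (-,+) and need not be distinct.
-/
theorem exists_corners_of_lines {c u v : Plane} (huv : cross u v ≠ 0) {δ : ℝ} (hδ : 0 < δ)
    (h : ∀ a b : ℝ, |a| < δ → |b| < δ → (c + a • u + b • v ∈ P.support ↔ a = 0 ∨ b = 0)) :
    ∃ A B C D : P.Region, IsCorners P c u v A B C D := by
  have hδ2 : 0 < δ / 2 := by positivity
  have hδ2' : δ / 2 < δ := by linarith
  obtain ⟨A, hA⟩ := exists_region_of_chart (P := P) c u v (S := Set.Ioo 0 δ ×ˢ Set.Ioo 0 δ)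
    ((convex_Ioo _ _).prod (convex_Ioo _ _)).isPreconnected
    ⟨(δ / 2, δ / 2), ⟨by constructor <;> simp [hδ], by constructor <;> simp [hδ]⟩⟩
    (by
      rintro ⟨a, b⟩ ⟨ha, hb⟩
      simp only [Set.mem_Ioo] at ha hb
      rw [h a b (abs_lt.mpr ⟨by linarith, by linarith⟩) (abs_lt.mpr ⟨by linarith, by linarith⟩)]
      rintro (h | h) <;> linarith)
  obtain ⟨B, hB⟩ := exists_region_of_chart (P := P) c u v (S := Set.Ioo 0 δ ×ˢ Set.Ioo (-δ) 0)
    ((convex_Ioo _ _).prod (convex_Ioo _ _)).isPreconnected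
    ⟨(δ / 2, -(δ / 2)), ⟨by constructor <;> simp [hδ], by constructor <;> simp [hδ]⟩⟩
    (by
      rintro ⟨a, b⟩ ⟨ha, hb⟩
      simp only [Set.mem_Ioo] at ha hb
      rw [h a b (abs_lt.mpr ⟨by linarith, by linarith⟩) (abs_lt.mpr ⟨by linarith, by linarith⟩)]
      rintro (h | h) <;> linarith)
  obtain ⟨C, hC⟩ := exists_region_of_chart (P := P) c u v (S := Set.Ioo (-δ) 0 ×ˢ Set.Ioo (-δ) 0)
    ((convex_Ioo _ _).prod (convex_Ioo _ _)).isPreconnected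
    ⟨(-(δ / 2), -(δ / 2)), ⟨by constructor <;> simp [hδ], by constructor <;> simp [hδ]⟩⟩
    (by
      rintro ⟨a, b⟩ ⟨ha, hb⟩
      simp only [Set.mem_Ioo] at ha hb
      rw [h a b (abs_lt.mpr ⟨by linarith, by linarith⟩) (abs_lt.mpr ⟨by linarith, by linarith⟩)]
      rintro (h | h) <;> linarith)
  obtain ⟨D, hD⟩ := exists_region_of_chart (P := P) c u v (S := Set.Ioo (-δ) 0 ×ˢ Set.Ioo 0 δ)
    ((convex_Ioo _ _).prod (convex_Ioo _ _)).isPreconnected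
    ⟨(-(δ / 2), δ / 2), ⟨by constructor <;> simp [hδ], by constructor <;> simp [hδ]⟩⟩
    (by
      rintro ⟨a, b⟩ ⟨ha, hb⟩
      simp only [Set.mem_Ioo] at ha hb
      rw [h a b (abs_lt.mpr ⟨by linarith, by linarith⟩) (abs_lt.mpr ⟨by linarith, by linarith⟩)]
      rintro (h | h) <;> linarith)
  have hu : ∀ a : ℝ, |a| < δ → c + a • u ∈ P.support := by
    intro a ha
    simpa using (h a 0 ha (by simpa using hδ)).mpr (Or.inr rfl)
  have hv : ∀ b : ℝ, |b| < δ → c + b • v ∈ P.support := by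
    intro b hb
    simpa using (h 0 b (by simpa using hδ) hb).mpr (Or.inl rfl)
  have hswap : ∀ a b : ℝ, c + b • v + a • u = c + a • u + b • v := by intros; module
  have hvu : cross v u ≠ 0 := by
    intro h0
    apply huv
    rw [cross] at h0 ⊢
    linarith
  refine ⟨A, B, C, D, huv, ?_, ?_, ?_⟩
  · refine eventually_of_box huv hδ fun a b ha hb => ?_
    have hab := h a b ha hb
    rw [abs_lt] at ha hb
    rcases lt_trichotomy a 0 with ha0 | ha0 | ha0
    · rcases lt_trichotomy b 0 with hb0 | hb0 | hb0
      · exact Or.inr (Or.inr (Or.inr (Or.inl (hC a b ⟨⟨ha.1, ha0⟩, ⟨hb.1, hb0⟩⟩))))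
      · exact Or.inl (hab.mpr (Or.inr hb0))
      · exact Or.inr (Or.inr (Or.inr (Or.inr (hD a b ⟨⟨ha.1, ha0⟩, ⟨hb0, hb.2⟩⟩))))
    · exact Or.inl (hab.mpr (Or.inl ha0))
    · rcases lt_trichotomy b 0 with hb0 | hb0 | hb0
      · exact Or.inr (Or.inr (Or.inl (hB a b ⟨⟨ha0, ha.2⟩, ⟨hb.1, hb0⟩⟩)))
      · exact Or.inl (hab.mpr (Or.inr hb0))
      · exact Or.inr (Or.inl (hA a b ⟨⟨ha0, ha.2⟩, ⟨hb0, hb.2⟩⟩))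
  · filter_upwards [eventually_pos_lt hδ] with t ht
    have e1 : c + t • (u + v) = c + t • u + t • v := by module
    have e2 : c + t • (u - v) = c + t • u + (-t) • v := by module
    have e3 : c - t • (u + v) = c + (-t) • u + (-t) • v := by module
    have e4 : c - t • (u - v) = c + (-t) • u + t • v := by module
    have ht' : -t ∈ Set.Ioo (-δ) 0 := ⟨by linarith, by linarith⟩
    rw [e1, e2, e3, e4]
    exact ⟨hA _ _ ⟨ht, ht⟩, hB _ _ ⟨ht, ht'⟩, hC _ _ ⟨ht', ht'⟩, hD _ _ ⟨ht', ht⟩⟩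
  · filter_upwards [eventually_pos_lt hδ] with t ht
    have e1 : c - t • u = c + (-t) • u := by module
    have e2 : c - t • v = c + (-t) • v := by module
    rw [e1, e2]
    refine ⟨?_, ?_, ?_, ?_⟩
    · exact sides_of_strip huv hδ ht.1 ht.2
        (fun a b h1 h2 h3 h4 => hA a b ⟨⟨h1, h2⟩, ⟨h3, h4⟩⟩)
        (fun a b h1 h2 h3 h4 => hB a b ⟨⟨h1, h2⟩, ⟨h3, h4⟩⟩)
        (fun a h1 h2 => hu a (abs_lt.mpr ⟨by linarith, by linarith⟩))
    · exact sides_of_strip huv hδ (α := -δ) (β := 0) (by linarith) (by linarith)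
        (fun a b h1 h2 h3 h4 => hD a b ⟨⟨h1, h2⟩, ⟨h3, h4⟩⟩)
        (fun a b h1 h2 h3 h4 => hC a b ⟨⟨h1, h2⟩, ⟨h3, h4⟩⟩)
        (fun a h1 h2 => hu a (abs_lt.mpr ⟨by linarith, by linarith⟩))
    · exact sides_of_strip hvu hδ ht.1 ht.2
        (fun a b h1 h2 h3 h4 => hswap b a ▸ hA b a ⟨⟨h3, h4⟩, ⟨h1, h2⟩⟩)
        (fun a b h1 h2 h3 h4 => hswap b a ▸ hD b a ⟨⟨h3, h4⟩, ⟨h1, h2⟩⟩)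
        (fun a h1 h2 => hv a (abs_lt.mpr ⟨by linarith, by linarith⟩))
    · exact sides_of_strip hvu hδ (α := -δ) (β := 0) (by linarith) (by linarith)
        (fun a b h1 h2 h3 h4 => hswap b a ▸ hB b a ⟨⟨h3, h4⟩, ⟨h1, h2⟩⟩)
        (fun a b h1 h2 h3 h4 => hswap b a ▸ hC b a ⟨⟨h3, h4⟩, ⟨h1, h2⟩⟩)
        (fun a h1 h2 => hv a (abs_lt.mpr ⟨by linarith, by linarith⟩))

/-- If the polygons look like two half-lines near `p`, then there are two regions near `p`. -/
theorem exists_sides_of_angle {p u v : Plane} (huv : cross u v ≠ 0) {δ : ℝ} (hδ : 0 < δ)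
    (h : ∀ a b : ℝ, |a| < δ → |b| < δ →
      (p + a • u + b • v ∈ P.support ↔ (b = 0 ∧ 0 ≤ a) ∨ (a = 0 ∧ 0 ≤ b))) :
    ∃ Q Q' : P.Region, (∀ᶠ t : ℝ in 𝓝[>] 0, P.Sides (p + t • u) Q Q' ∧ P.Sides (p + t • v) Q Q') ∧
      ∀ᶠ q in 𝓝 p, q ∈ P.support ∨ q ∈ Q.1 ∨ q ∈ Q'.1 := by
  obtain ⟨Q, hQ⟩ := exists_region_of_chart (P := P) p u v (S := Set.Ioo 0 δ ×ˢ Set.Ioo 0 δ)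
    ((convex_Ioo _ _).prod (convex_Ioo _ _)).isPreconnected
    ⟨(δ / 2, δ / 2), ⟨by constructor <;> simp [hδ], by constructor <;> simp [hδ]⟩⟩
    (by
      rintro ⟨a, b⟩ ⟨ha, hb⟩
      simp only [Set.mem_Ioo] at ha hb
      rw [h a b (abs_lt.mpr ⟨by linarith, by linarith⟩) (abs_lt.mpr ⟨by linarith, by linarith⟩)]
      rintro (h | h) <;> linarith)
  -- The reflex side of the angle: two rectangles that share the quadrant (-,-).
  have hpre : IsPreconnected
      (Set.Ioo (-δ) 0 ×ˢ Set.Ioo (-δ) δ ∪ Set.Ioo (-δ) δ ×ˢ Set.Ioo (-δ) 0) := by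
    refine IsPreconnected.union (-(δ / 2), -(δ / 2)) ?_ ?_
      ((convex_Ioo _ _).prod (convex_Ioo _ _)).isPreconnected
      ((convex_Ioo _ _).prod (convex_Ioo _ _)).isPreconnected
    · refine ⟨⟨?_, ?_⟩, ⟨?_, ?_⟩⟩ <;> simp <;> linarith
    · refine ⟨⟨?_, ?_⟩, ⟨?_, ?_⟩⟩ <;> simp <;> linarith
  obtain ⟨Q', hQ'⟩ := exists_region_of_chart (P := P) p u v hpre
    ⟨(-(δ / 2), 0), Or.inl ⟨⟨by simp; linarith, by simp; linarith⟩, ⟨by simp [hδ], by simp [hδ]⟩⟩⟩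
    (by
      rintro ⟨a, b⟩ (⟨ha, hb⟩ | ⟨ha, hb⟩) <;> simp only [Set.mem_Ioo] at ha hb <;>
      · rw [h a b (abs_lt.mpr ⟨by linarith, by linarith⟩) (abs_lt.mpr ⟨by linarith, by linarith⟩)]
        rintro (h | h) <;> linarith)
  have hswap : ∀ a b : ℝ, p + b • v + a • u = p + a • u + b • v := by intros; module
  have hvu : cross v u ≠ 0 := by
    intro h0
    apply huv
    rw [cross] at h0 ⊢
    linarith
  refine ⟨Q, Q', ?_, ?_⟩
  · filter_upwards [eventually_pos_lt hδ] with t ht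
    constructor
    · refine sides_of_strip huv hδ ht.1 ht.2
        (fun a b h1 h2 h3 h4 => hQ a b ⟨⟨h1, h2⟩, ⟨h3, h4⟩⟩)
        (fun a b h1 h2 h3 h4 => hQ' a b (Or.inr ⟨⟨by linarith, h2⟩, ⟨h3, h4⟩⟩))
        (fun a h1 h2 => ?_)
      simpa using (h a 0 (abs_lt.mpr ⟨by linarith, by linarith⟩) (by simpa using hδ)).mpr
        (Or.inl ⟨rfl, h1.le⟩)
    · refine sides_of_strip hvu hδ ht.1 ht.2
        (fun a b h1 h2 h3 h4 => hswap b a ▸ hQ b a ⟨⟨h3, h4⟩, ⟨h1, h2⟩⟩)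
        (fun a b h1 h2 h3 h4 => hswap b a ▸ hQ' b a (Or.inl ⟨⟨h3, h4⟩, ⟨by linarith, h2⟩⟩))
        (fun a h1 h2 => ?_)
      simpa using (h 0 a (by simpa using hδ) (abs_lt.mpr ⟨by linarith, by linarith⟩)).mpr
        (Or.inr ⟨rfl, h1.le⟩)
  · refine eventually_of_box huv hδ fun a b ha hb => ?_
    have hab := h a b ha hb
    rw [abs_lt] at ha hb
    by_cases ha0 : a < 0
    · exact Or.inr (Or.inr (hQ' a b (Or.inl ⟨⟨ha.1, ha0⟩, hb⟩)))
    by_cases hb0 : b < 0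
    · exact Or.inr (Or.inr (hQ' a b (Or.inr ⟨ha, ⟨hb.1, hb0⟩⟩)))
    push Not at ha0 hb0
    rcases ha0.eq_or_lt with ha1 | ha1
    · exact Or.inl (hab.mpr (Or.inr ⟨ha1.symm, hb0⟩))
    rcases hb0.eq_or_lt with hb1 | hb1
    · exact Or.inl (hab.mpr (Or.inl ⟨hb1.symm, ha0⟩))
    exact Or.inr (Or.inl (hQ a b ⟨⟨ha1, ha.2⟩, ⟨hb1, hb.2⟩⟩))

end PolygonSystem

/-! ### Local structure of a regular system: generic points, crossings, vertices -/

namespace PolygonSystem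

variable {n : ℕ} {P : PolygonSystem n}

variable (P) in
/-- The direction vector of an edge. -/
def dir (e : P.Edge) : Plane := P.start (P.next e) - P.start e

variable (P) in
/-- `p` is an inner point of the edge `e`. -/
def IsInner (e : P.Edge) (p : Plane) : Prop := ∃ s : ℝ, 0 < s ∧ s < 1 ∧ p = P.start e + s • P.dir e

variable (P) in
/-- `p` is an inner point of the edge `e`, and lies on no other edge. -/
def IsGeneric (e : P.Edge) (p : Plane) : Prop := P.IsInner e p ∧ ∀ f, p ∈ P.seg f → f = e

variable (P) in
/-- `p` is an inner point of exactly two edges, `e` and `f`. -/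
structure IsCrossing (e f : P.Edge) (p : Plane) : Prop where
  ne : e ≠ f
  next_ne : P.next e ≠ f
  next_ne' : P.next f ≠ e
  inner_left : P.IsInner e p
  inner_right : P.IsInner f p
  eq_or_eq : ∀ g, p ∈ P.seg g → g = e ∨ g = f

theorem IsCrossing.symm {e f : P.Edge} {p : Plane} (h : P.IsCrossing e f p) :
    P.IsCrossing f e p :=
  ⟨h.ne.symm, h.next_ne', h.next_ne, h.inner_right, h.inner_left, fun g hg => (h.eq_or_eq g hg).symm⟩

theorem mem_seg_iff {e : P.Edge} {p : Plane} :
    p ∈ P.seg e ↔ ∃ s : ℝ, 0 ≤ s ∧ s ≤ 1 ∧ p = P.start e + s • P.dir e := by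
  rw [seg, segment_eq_image']
  constructor
  · rintro ⟨s, ⟨h0, h1⟩, rfl⟩
    exact ⟨s, h0, h1, rfl⟩
  · rintro ⟨s, h0, h1, rfl⟩
    exact ⟨s, ⟨h0, h1⟩, rfl⟩

theorem IsInner.mem_seg {e : P.Edge} {p : Plane} (h : P.IsInner e p) : p ∈ P.seg e := by
  obtain ⟨s, h0, h1, rfl⟩ := h
  exact mem_seg_iff.mpr ⟨s, h0.le, h1.le, rfl⟩

theorem start_mem_seg_self (e : P.Edge) : P.start e ∈ P.seg e := left_mem_segment ℝ _ _

theorem start_next_mem_seg (e : P.Edge) : P.start (P.next e) ∈ P.seg e := right_mem_segment ℝ _ _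

theorem next_ne (e : P.Edge) : P.next e ≠ e := by
  obtain ⟨i, j⟩ := e
  have h3 := P.three_le_size i
  have : Fact (1 < P.size i) := ⟨by omega⟩
  intro h
  simp [next] at h

theorem next_next_ne (e : P.Edge) : P.next (P.next e) ≠ e := by
  obtain ⟨i, j⟩ := e
  have h3 := P.three_le_size i
  intro h
  simp only [next, Sigma.mk.injEq, heq_eq_eq, true_and] at h
  have h' : j + 1 + 1 = j := h
  have h2 : (1 : ZMod (P.size i)) + 1 = 0 := by
    rw [add_assoc] at h'
    simpa using h'
  have h4 : ((2 : ℕ) : ZMod (P.size i)) = 0 := by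
    rw [← h2]; push_cast; ring
  rw [ZMod.natCast_eq_zero_iff] at h4
  have := Nat.le_of_dvd (by norm_num) h4
  omega

theorem exists_next_eq (e : P.Edge) : ∃ f, P.next f = e :=
  ⟨⟨e.1, e.2 - 1⟩, by simp [next]⟩

namespace IsRegular

variable (hP : P.IsRegular)

include hP

theorem dir_ne_zero (e : P.Edge) : P.dir e ≠ 0 := by
  intro h
  rw [dir, sub_eq_zero] at h
  rcases hP.start_mem_seg e (P.next e) (h ▸ start_mem_seg_self _) with h1 | h1
  · exact next_ne e h1
  · exact next_next_ne e h1

/-- Consecutive edges do not fold back: otherwise the far end of the shorter one would lie on the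
longer one. -/
theorem dir_next_ne {e : P.Edge} {r : ℝ} (hr : 0 < r) : P.dir (P.next e) ≠ -(r • P.dir e) := by
  intro h
  rcases le_total r 1 with h1 | h1
  · have hmem : P.start (P.next (P.next e)) ∈ P.seg e := by
      refine mem_seg_iff.mpr ⟨1 - r, by linarith, by linarith, ?_⟩
      have : P.start (P.next (P.next e)) = P.start e + P.dir e + P.dir (P.next e) := by
        simp only [dir]; module
      rw [this, h]
      module
    rcases hP.start_mem_seg _ _ hmem with h2 | h2
    · exact next_next_ne _ h2.symm
    · exact next_ne _ (P.next_injective h2).symm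
  · have hmem : P.start e ∈ P.seg (P.next e) := by
      refine mem_seg_iff.mpr ⟨1 / r, by positivity, ?_, ?_⟩
      · rw [div_le_one hr]; exact h1
      have : P.start (P.next e) = P.start e + P.dir e := by
        simp only [dir]; module
      rw [this, h, smul_neg, smul_smul, one_div, inv_mul_cancel₀ hr.ne']
      module
    rcases hP.start_mem_seg _ _ hmem with h2 | h2
    · exact next_ne _ h2
    · exact next_next_ne _ h2

omit hP in
theorem isInner_or {e : P.Edge} {p : Plane} (h : p ∈ P.seg e) :
    P.IsInner e p ∨ p = P.start e ∨ p = P.start (P.next e) := by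
  obtain ⟨s, h0, h1, rfl⟩ := mem_seg_iff.mp h
  rcases h0.eq_or_lt with rfl | h0
  · right; left; simp
  rcases h1.eq_or_lt with rfl | h1
  · right; right; simp [dir]
  · exact Or.inl ⟨s, h0, h1, rfl⟩

theorem notMem_next_of_isInner {e : P.Edge} {p : Plane} (h : P.IsInner e p) :
    p ∉ P.seg (P.next e) := by
  intro hp
  obtain ⟨s, h0, h1, rfl⟩ := h
  obtain ⟨t, ht0, ht1, ht⟩ := mem_seg_iff.mp hp
  have h2 : P.start (P.next e) = P.start e + P.dir e := by
    simp only [dir]; module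
  rw [h2, add_assoc, add_right_inj] at ht
  have h3 : t • P.dir (P.next e) = -((1 - s) • P.dir e) := by
    rw [eq_comm, ← sub_eq_zero] at ht
    have : t • P.dir (P.next e) + (1 - s) • P.dir e = 0 := by
      rw [← ht]; module
    exact eq_neg_of_add_eq_zero_left this
  rcases ht0.eq_or_lt with rfl | ht0
  · rw [zero_smul, zero_eq_neg, smul_eq_zero] at h3
    rcases h3 with h3 | h3
    · linarith
    · exact hP.dir_ne_zero e h3
  · refine hP.dir_next_ne (e := e) (r := (1 - s) / t) (div_pos (by linarith) ht0) ?_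
    rw [← inv_smul_smul₀ ht0.ne' (P.dir (P.next e)), h3, smul_neg, smul_smul, div_eq_inv_mul]

/-- An inner point of an edge is no vertex and lies on no neighbouring edge, so a second edge
through it crosses there; a third edge is excluded by `no_triple_point`. -/
theorem isGeneric_or_isCrossing {e : P.Edge} {p : Plane} (h : P.IsInner e p) :
    P.IsGeneric e p ∨ ∃ f, P.IsCrossing e f p := by
  by_cases hg : ∀ f, p ∈ P.seg f → f = e
  · exact Or.inl ⟨h, hg⟩
  push Not at hg
  obtain ⟨f, hf, hfe⟩ := hg
  have hvert : ∀ e g : P.Edge, P.IsInner e p → p ≠ P.start g := by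
    rintro e g he rfl
    rcases hP.start_mem_seg _ _ he.mem_seg with h1 | h1
    · subst h1
      obtain ⟨s, h0, h1, h2⟩ := he
      have : s • P.dir e = 0 := by simpa using h2.symm
      rw [smul_eq_zero] at this
      exact this.elim h0.ne' (hP.dir_ne_zero e)
    · subst h1
      exact hP.notMem_next_of_isInner he (start_mem_seg_self _)
  have hfi : P.IsInner f p := by
    rcases isInner_or hf with h1 | h1 | h1
    · exact h1
    · exact absurd h1 (hvert e _ h)
    · exact absurd h1 (hvert e _ h)
  refine Or.inr ⟨f, ⟨hfe.symm, ?_, ?_, h, hfi, ?_⟩⟩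
  · rintro rfl
    exact hP.notMem_next_of_isInner h hf
  · rintro rfl
    exact hP.notMem_next_of_isInner hfi h.mem_seg
  · intro g hg
    rcases hP.no_triple_point e f g p h.mem_seg hf hg with h1 | h1 | h1
    · exact absurd h1.symm hfe
    · exact Or.inr h1.symm
    · exact Or.inl h1.symm

theorem mem_support_cases {p : Plane} (h : p ∈ P.support) :
    (∃ e, p = P.start (P.next e)) ∨ (∃ e, P.IsGeneric e p) ∨ ∃ e f, P.IsCrossing e f p := by
  obtain ⟨e, he⟩ := mem_support.mp h
  rcases isInner_or he with h1 | h1 | h1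
  · rcases hP.isGeneric_or_isCrossing h1 with h2 | ⟨f, h2⟩
    · exact Or.inr (Or.inl ⟨e, h2⟩)
    · exact Or.inr (Or.inr ⟨e, f, h2⟩)
  · obtain ⟨f, rfl⟩ := exists_next_eq e
    exact Or.inl ⟨f, h1⟩
  · exact Or.inl ⟨e, h1⟩

theorem exists_isCrossing {p : Plane} (h : p ∈ P.doublePoints) : ∃ e f, P.IsCrossing e f p := by
  obtain ⟨e, f, h1, h2, h3, he, hf⟩ := h
  have hvert : ∀ g : P.Edge, p ≠ P.start g := by
    rintro g rfl
    have := hP.start_mem_seg _ _ he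
    have := hP.start_mem_seg _ _ hf
    have := P.next_injective (a₁ := e) (a₂ := f)
    grind
  refine ⟨e, f, ⟨h1, h2, h3, ?_, ?_, ?_⟩⟩
  · rcases isInner_or he with h | h | h
    · exact h
    · exact absurd h (hvert _)
    · exact absurd h (hvert _)
  · rcases isInner_or hf with h | h | h
    · exact h
    · exact absurd h (hvert _)
    · exact absurd h (hvert _)
  · intro g hg
    rcases hP.no_triple_point e f g p he hf hg with h | h | h
    · exact absurd h h1
    · exact Or.inr h.symm
    · exact Or.inl h.symm

/-- Parallel edges through a common inner point would share a second point, and then an end point of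
one would lie on the other. -/
theorem cross_dir_ne_zero {e f : P.Edge} {p : Plane} (h : P.IsCrossing e f p) :
    cross (P.dir e) (P.dir f) ≠ 0 := by
  intro h0
  obtain ⟨r, hr⟩ := exists_smul_of_cross_eq_zero (hP.dir_ne_zero e) h0
  have hr0 : r ≠ 0 := by
    rintro rfl
    exact hP.dir_ne_zero f (by simpa using hr)
  obtain ⟨s, hs0, hs1, hs⟩ := h.inner_left
  obtain ⟨t, ht0, ht1, ht⟩ := h.inner_right
  -- The second common point is `p + a • P.dir e`. Its parameter on `f` is `t + a / r`; since `r`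
  -- may have either sign, both bounds are needed.
  have hev : ∀ᶠ a : ℝ in 𝓝[>] 0, (s + a < 1 ∧ t + a / r < 1) ∧ 0 < t + a / r := by
    refine Eventually.filter_mono nhdsWithin_le_nhds ((Eventually.and ?_ ?_).and ?_)
    · exact (continuousAt_const.add continuousAt_id).eventually_lt
        (continuousAt_const (y := (1 : ℝ))) (by simpa using hs1)
    · exact (continuousAt_const.add (continuousAt_id.div_const r)).eventually_lt
        (continuousAt_const (y := (1 : ℝ))) (by simpa using ht1)
    · exact (continuousAt_const (y := (0 : ℝ))).eventually_lt
        (continuousAt_const.add (continuousAt_id.div_const r)) (by simpa using ht0)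
  obtain ⟨a, ⟨⟨h1, h2⟩, h3⟩, ha⟩ := (hev.and self_mem_nhdsWithin).exists
  have ha : 0 < a := ha
  have hne : p ≠ p + a • P.dir e := by
    simp [ha.ne', hP.dir_ne_zero e]
  have hq : p + a • P.dir e ∈ P.seg e :=
    mem_seg_iff.mpr ⟨s + a, by linarith, h1.le, by rw [hs]; module⟩
  have hq' : p + a • P.dir e ∈ P.seg f := by
    refine mem_seg_iff.mpr ⟨t + a / r, h3.le, h2.le, ?_⟩
    rw [ht, hr, add_smul, smul_smul (a / r), div_mul_cancel₀ _ hr0]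
    module
  have hi := P.next_injective (a₁ := e) (a₂ := f)
  have := h.ne
  have := h.next_ne
  have := h.next_ne'
  rcases endpoint_mem_of_two_common hne h.inner_left.mem_seg hq h.inner_right.mem_seg hq'
    with h4 | h4 | h4
  · have := hP.start_mem_seg _ _ h4
    grind
  · have := hP.start_mem_seg _ _ h4
    grind
  · have := hP.start_mem_seg _ _ h4
    grind

omit hP in
theorem inner_chart_mem_seg {e : P.Edge} {p v : Plane} (h : P.IsInner e p)
    (hv : cross (P.dir e) v ≠ 0) :
    ∃ δ > 0, ∀ a b : ℝ, |a| < δ → (p + a • P.dir e + b • v ∈ P.seg e ↔ b = 0) := by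
  obtain ⟨s, h0, h1, rfl⟩ := h
  refine ⟨min s (1 - s), lt_min h0 (by linarith), fun a b ha => ?_⟩
  rw [abs_lt] at ha
  have h2 := min_le_left s (1 - s)
  have h3 := min_le_right s (1 - s)
  have h4 : P.start e + s • P.dir e + a • P.dir e + b • v =
      P.start e + (s + a) • (P.start (P.next e) - P.start e) + b • v := by
    rw [dir]; module
  rw [h4, seg, chart_mem_segment_iff hv]
  exact ⟨fun h => h.1, fun h => ⟨h, by linarith, by linarith⟩⟩

omit hP in
theorem isGeneric_chart {e : P.Edge} {p v : Plane} (h : P.IsGeneric e p)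
    (hv : cross (P.dir e) v ≠ 0) : ∃ δ > 0, ∀ a b : ℝ, |a| < δ → |b| < δ →
      (p + a • P.dir e + b • v ∈ P.support ↔ b = 0) := by
  obtain ⟨δ, hδ, h1⟩ := inner_chart_mem_seg h.1 hv
  obtain ⟨η, hη, h2⟩ := exists_box_of_eventually (u := P.dir e) (v := v) (P.eventually_mem_seg p)
  refine ⟨min δ η, lt_min hδ hη, fun a b ha hb => ?_⟩
  rw [← h1 a b (ha.trans_le (min_le_left _ _)), mem_support]
  constructor
  · rintro ⟨f, hf⟩
    have hfe := h.2 f (h2 a b (ha.trans_le (min_le_right _ _)) (hb.trans_le (min_le_right _ _)) f hf)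
    rwa [hfe] at hf
  · exact fun h => ⟨e, h⟩

omit hP in
theorem eventually_isInner {e : P.Edge} {p : Plane} (h : P.IsInner e p) :
    ∀ᶠ a : ℝ in 𝓝 0, P.IsInner e (p + a • P.dir e) := by
  obtain ⟨s, h0, h1, rfl⟩ := h
  have c1 : ∀ᶠ a : ℝ in 𝓝 0, 0 < s + a :=
    (continuousAt_const (y := (0 : ℝ))).eventually_lt (continuousAt_const.add continuousAt_id)
      (by simpa using h0)
  have c2 : ∀ᶠ a : ℝ in 𝓝 0, s + a < 1 :=
    (continuousAt_const.add continuousAt_id).eventually_lt (continuousAt_const (y := (1 : ℝ)))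
      (by simpa using h1)
  filter_upwards [c1, c2] with a h2 h3
  exact ⟨s + a, h2, h3, by module⟩

omit hP in
theorem tendsto_ray (p w : Plane) : Tendsto (fun a : ℝ => p + a • w) (𝓝 0) (𝓝 p) := by
  have : ContinuousAt (fun a : ℝ => p + a • w) 0 := by fun_prop
  simpa [ContinuousAt] using this

omit hP in
theorem exists_sides {e : P.Edge} {p v : Plane} (h : P.IsGeneric e p)
    (hv : cross (P.dir e) v ≠ 0) : ∃ Q Q' : P.Region,
      (∀ᶠ t : ℝ in 𝓝[>] 0, p + t • v ∈ Q.1 ∧ p - t • v ∈ Q'.1) ∧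
      ∀ᶠ a in 𝓝 (0 : ℝ), P.Sides (p + a • P.dir e) Q Q' := by
  obtain ⟨δ, hδ, h1⟩ := isGeneric_chart h hv
  obtain ⟨Q, Q', h2, h3⟩ := exists_sides_of_line hv hδ h1
  refine ⟨Q, Q', h2, ?_⟩
  filter_upwards [Metric.ball_mem_nhds (0 : ℝ) hδ] with a ha
  exact h3 a (by simpa using ha)

theorem exists_corners {e f : P.Edge} {c : Plane} (h : P.IsCrossing e f c) :
    ∃ A B C D : P.Region, IsCorners P c (P.dir e) (P.dir f) A B C D := by
  have huv := hP.cross_dir_ne_zero h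
  have hvu := hP.cross_dir_ne_zero h.symm
  obtain ⟨δ, hδ, h1⟩ := inner_chart_mem_seg h.inner_left huv
  obtain ⟨δ', hδ', h1'⟩ := inner_chart_mem_seg h.inner_right hvu
  obtain ⟨η, hη, h2⟩ := exists_box_of_eventually (u := P.dir e) (v := P.dir f)
    (P.eventually_mem_seg c)
  refine exists_corners_of_lines huv (lt_min hη (lt_min hδ hδ')) fun a b ha hb => ?_
  simp only [lt_min_iff] at ha hb
  have e1 := h1 a b ha.2.1
  have e2 := h1' b a hb.2.2
  rw [show c + b • P.dir f + a • P.dir e = c + a • P.dir e + b • P.dir f by module] at e2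
  rw [← e1, ← e2, mem_support]
  constructor
  · rintro ⟨g, hg⟩
    rcases h.eq_or_eq g (h2 a b ha.1 hb.1 g hg) with rfl | rfl
    · exact Or.inr hg
    · exact Or.inl hg
  · rintro (h | h)
    exacts [⟨f, h⟩, ⟨e, h⟩]

theorem eventually_isGeneric_of_isCrossing {e f : P.Edge} {c : Plane} (h : P.IsCrossing e f c) :
    ∀ᶠ a : ℝ in 𝓝[≠] 0, P.IsGeneric e (c + a • P.dir e) := by
  have hvu := hP.cross_dir_ne_zero h.symm
  obtain ⟨δ', hδ', h1'⟩ := inner_chart_mem_seg h.inner_right hvu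
  have h2 : ∀ᶠ a : ℝ in 𝓝[≠] 0, P.IsInner e (c + a • P.dir e) :=
    (eventually_isInner h.inner_left).filter_mono nhdsWithin_le_nhds
  have h3 : ∀ᶠ a : ℝ in 𝓝[≠] 0, ∀ g, c + a • P.dir e ∈ P.seg g → c ∈ P.seg g :=
    ((tendsto_ray c (P.dir e)).eventually (P.eventually_mem_seg c)).filter_mono nhdsWithin_le_nhds
  filter_upwards [h2, h3, self_mem_nhdsWithin] with a h4 h5 ha
  refine ⟨h4, fun g hg => ?_⟩
  rcases h.eq_or_eq g (h5 g hg) with rfl | rfl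
  · rfl
  · have := (h1' 0 a (by simpa using hδ')).mp (by simpa using hg)
    exact absurd this ha

theorem eq_or_eq_of_start_mem {e f : P.Edge} (h : P.start (P.next e) ∈ P.seg f) :
    f = e ∨ f = P.next e := by
  rcases hP.start_mem_seg _ _ h with h | h
  · exact Or.inr h
  · exact Or.inl (P.next_injective h)

/-- The same pair of regions accompanies the incoming and the outgoing edge; this carries jumps past
vertices. -/
theorem exists_sides_vertex (e : P.Edge) : ∃ Q Q' : P.Region,
    (∀ᶠ t : ℝ in 𝓝[>] 0, P.Sides (P.start (P.next e) - t • P.dir e) Q Q' ∧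
      P.Sides (P.start (P.next e) + t • P.dir (P.next e)) Q Q') ∧
    ∀ᶠ q in 𝓝 (P.start (P.next e)), q ∈ P.support ∨ q ∈ Q.1 ∨ q ∈ Q'.1 := by
  set p := P.start (P.next e) with hp
  set u := P.dir e with hu
  set w := P.dir (P.next e) with hw
  have hu0 : u ≠ 0 := hP.dir_ne_zero e
  have hmem : ∀ q : Plane, (∀ f, q ∈ P.seg f → p ∈ P.seg f) →
      (q ∈ P.support ↔ q ∈ P.seg e ∨ q ∈ P.seg (P.next e)) := by
    intro q hq
    rw [mem_support]
    constructor
    · rintro ⟨f, hf⟩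
      rcases hP.eq_or_eq_of_start_mem (hq f hf) with rfl | rfl
      exacts [Or.inl hf, Or.inr hf]
    · rintro (h | h)
      exacts [⟨_, h⟩, ⟨_, h⟩]
  have hpe : P.start e + u = p := by simp only [hu, dir, hp]; module
  -- A straight vertex looks like a line. Otherwise the two edges look like half-lines in the
  -- directions `-u` and `w`.
  by_cases huw : cross u w = 0
  · obtain ⟨r, hr⟩ := exists_smul_of_cross_eq_zero hu0 huw
    have hr0 : 0 < r := by
      rcases lt_trichotomy r 0 with h | h | h
      · refine absurd ?_ (hP.dir_next_ne (e := e) (r := -r) (by linarith))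
        rw [← hw, ← hu, hr]; module
      · refine absurd ?_ (hP.dir_ne_zero (P.next e))
        rw [← hw, hr, h, zero_smul]
      · exact h
    obtain ⟨v, hv⟩ := exists_cross_ne_zero hu0
    have hwv : cross w v ≠ 0 := by
      have : cross w v = r * cross u v := by
        rw [hr]; simp [cross]; ring
      rw [this]
      exact mul_ne_zero hr0.ne' hv
    obtain ⟨η, hη, h2⟩ := exists_box_of_eventually (u := u) (v := v) (P.eventually_mem_seg p)
    have hδ : 0 < min η (min 1 r) := lt_min hη (lt_min one_pos hr0)
    have hloc : ∀ a b : ℝ, |a| < min η (min 1 r) → |b| < min η (min 1 r) →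
        (p + a • u + b • v ∈ P.support ↔ b = 0) := by
      intro a b ha hb
      simp only [lt_min_iff] at ha hb
      rw [hmem _ (h2 a b ha.1 hb.1)]
      have e1 : p + a • u + b • v =
          P.start e + (1 + a) • (P.start (P.next e) - P.start e) + b • v := by
        change p + a • u + b • v = P.start e + (1 + a) • u + b • v
        rw [← hpe]; module
      have e2 : p + a • u + b • v = P.start (P.next e) +
          (a / r) • (P.start (P.next (P.next e)) - P.start (P.next e)) + b • v := by
        change p + a • u + b • v = p + (a / r) • w + b • v
        rw [hr, smul_smul, div_mul_cancel₀ _ hr0.ne']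
      have m1 : p + a • u + b • v ∈ P.seg e ↔ b = 0 ∧ 0 ≤ 1 + a ∧ 1 + a ≤ 1 := by
        rw [e1, seg, chart_mem_segment_iff hv]
      have m2 : p + a • u + b • v ∈ P.seg (P.next e) ↔ b = 0 ∧ 0 ≤ a / r ∧ a / r ≤ 1 := by
        rw [e2, seg, chart_mem_segment_iff hwv]
      rw [m1, m2, div_le_one hr0, le_div_iff₀ hr0, zero_mul]
      have h3 := abs_lt.mp ha.2.1
      have h4 := abs_lt.mp ha.2.2
      constructor
      · rintro (h | h) <;> exact h.1
      · intro h
        rcases le_total a 0 with h5 | h5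
        · exact Or.inl ⟨h, by linarith, by linarith⟩
        · exact Or.inr ⟨h, h5, h4.2.le⟩
    obtain ⟨Q, Q', -, h4⟩ := exists_sides_of_line hv hδ hloc
    refine ⟨Q, Q', ?_, ?_⟩
    · have hd : 0 < min η (min 1 r) / max 1 r := div_pos hδ (by positivity)
      filter_upwards [eventually_pos_lt hd] with t ht
      rw [lt_div_iff₀ (by positivity)] at ht
      have hm1 := le_max_left 1 r
      have hm2 := le_max_right 1 r
      constructor
      · have := h4 (-t) (by rw [abs_neg, abs_of_pos ht.1]; nlinarith)
        convert this using 1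
        module
      · have := h4 (t * r) (by rw [abs_of_pos (mul_pos ht.1 hr0)]; nlinarith)
        convert this using 1
        rw [hr]; module
    · have h5 := (h4 0 (by simpa using hδ)).2.2
      simpa using h5
  · have hnu : cross (-u) w ≠ 0 := by
      have : cross (-u) w = -cross u w := by simp [cross]; ring
      rwa [this, neg_ne_zero]
    have hwu : cross w u ≠ 0 := by
      have : cross w u = -cross u w := by simp [cross]; ring
      rwa [this, neg_ne_zero]
    obtain ⟨η, hη, h2⟩ := exists_box_of_eventually (u := -u) (v := w) (P.eventually_mem_seg p)
    have hδ : 0 < min η 1 := lt_min hη one_pos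
    have hloc : ∀ a b : ℝ, |a| < min η 1 → |b| < min η 1 →
        (p + a • (-u) + b • w ∈ P.support ↔ (b = 0 ∧ 0 ≤ a) ∨ (a = 0 ∧ 0 ≤ b)) := by
      intro a b ha hb
      simp only [lt_min_iff] at ha hb
      rw [hmem _ (h2 a b ha.1 hb.1)]
      have e1 : p + a • (-u) + b • w =
          P.start e + (1 - a) • (P.start (P.next e) - P.start e) + b • w := by
        change p + a • (-u) + b • w = P.start e + (1 - a) • u + b • w
        rw [← hpe]; module
      have e2 : p + a • (-u) + b • w = P.start (P.next e) +
          b • (P.start (P.next (P.next e)) - P.start (P.next e)) + (-a) • u := by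
        change p + a • (-u) + b • w = p + b • w + (-a) • u
        module
      have m1 : p + a • (-u) + b • w ∈ P.seg e ↔ b = 0 ∧ 0 ≤ 1 - a ∧ 1 - a ≤ 1 := by
        rw [e1, seg, chart_mem_segment_iff (by exact huw)]
      have m2 : p + a • (-u) + b • w ∈ P.seg (P.next e) ↔ -a = 0 ∧ 0 ≤ b ∧ b ≤ 1 := by
        rw [e2, seg, chart_mem_segment_iff (by exact hwu)]
      rw [m1, m2]
      have h3 := abs_lt.mp ha.2
      have h4 := abs_lt.mp hb.2
      constructor
      · rintro (h | h)
        · exact Or.inl ⟨h.1, by linarith⟩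
        · exact Or.inr ⟨by linarith, h.2.1⟩
      · rintro (h | h)
        · exact Or.inl ⟨h.1, by linarith, by linarith⟩
        · exact Or.inr ⟨by linarith, h.2, by linarith⟩
    obtain ⟨Q, Q', h3, h4⟩ := exists_sides_of_angle hnu hδ hloc
    refine ⟨Q, Q', ?_, h4⟩
    filter_upwards [h3] with t ht
    refine ⟨?_, ht.2⟩
    convert ht.1 using 1
    module

end IsRegular

end PolygonSystem

/-! ### Connectedness arguments; winding parities as functions of the region -/

theorem IsPreconnected.forall_or_forall {X : Type*} [TopologicalSpace X] {S : Set X}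
    (hS : IsPreconnected S) {A B : X → Prop} (hA : ∀ q, A q → ∀ᶠ q' in 𝓝 q, A q')
    (hB : ∀ q, B q → ∀ᶠ q' in 𝓝 q, B q') (hAB : ∀ q ∈ S, A q ∨ B q)
    (hd : ∀ q ∈ S, A q → ¬B q) : (∀ q ∈ S, A q) ∨ ∀ q ∈ S, B q := by
  by_contra! h
  obtain ⟨⟨a, ha, haA⟩, ⟨b, hb, hbB⟩⟩ := h
  obtain ⟨q, hq, hqA, hqB⟩ := hS {q | A q} {q | B q} (isOpen_iff_eventually.mpr hA)
    (isOpen_iff_eventually.mpr hB) hAB ⟨b, hb, (hAB b hb).resolve_right hbB⟩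
    ⟨a, ha, (hAB a ha).resolve_left haA⟩
  exact hd q hq hqA hqB

theorem IsPreconnected.eq_of_eventually_eq {X α : Type*} [TopologicalSpace X] {S : Set X}
    (hS : IsPreconnected S) {g : X → α} (hg : ∀ q ∈ S, ∀ᶠ q' in 𝓝 q, g q' = g q) {p q : X}
    (hp : p ∈ S) (hq : q ∈ S) : g p = g q := by
  refine (hS.forall_or_forall (A := fun r => ∀ᶠ r' in 𝓝 r, g r' = g q)
    (B := fun r => ∀ᶠ r' in 𝓝 r, g r' ≠ g q) (fun r hr => hr.eventually_nhds)
    (fun r hr => hr.eventually_nhds) ?_ (fun r _ h1 h2 => h2.self_of_nhds h1.self_of_nhds)).elim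
    (fun h => ?_) (fun h => ?_)
  · intro r hr
    by_cases h : g r = g q
    · exact Or.inl ((hg r hr).mono fun r' h' => h'.trans h)
    · exact Or.inr ((hg r hr).mono fun r' h' => h' ▸ h)
  · exact (h p hp).self_of_nhds
  · exact absurd rfl (h q hq).self_of_nhds

namespace PolygonSystem

variable {n : ℕ} {P : PolygonSystem n}

/-- The parity of the winding number of the `i`-th polygon. -/
noncomputable def componentParity (P : PolygonSystem n) (i : Fin n) : Plane → ZMod 2 :=
  planeParity (fun l : ℕ => P.vertex i (l : ZMod (P.size i))) (P.size i)

theorem exists_lt_vertex_eq (i : Fin n) (j : ℕ) : ∃ k < P.size i,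
    P.vertex i (j : ZMod (P.size i)) = P.vertex i (k : ZMod (P.size i)) := by
  refine ⟨j % P.size i, Nat.mod_lt _ (by have := P.three_le_size i; omega), ?_⟩
  rw [ZMod.natCast_mod]

theorem segment_vertex (i : Fin n) (j : ℕ) :
    segment ℝ (P.vertex i (j : ZMod (P.size i))) (P.vertex i ((j + 1 : ℕ) : ZMod (P.size i))) =
      P.seg ⟨i, (j : ZMod (P.size i))⟩ := by
  rw [seg, start, start, next, Nat.cast_succ]

theorem eventually_componentParity_eq {i : Fin n} {q : Plane}
    (h : ∀ e : P.Edge, e.1 = i → q ∉ P.seg e) :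
    ∀ᶠ q' in 𝓝 q, P.componentParity i q' = P.componentParity i q := by
  refine eventually_planeParity_eq (exists_lt_vertex_eq i) (by simp) fun j _ => ?_
  rw [segment_vertex]
  exact h _ rfl

/-- A generic point lies on a single edge, which is what `planeParity_jump` demands; the labels in
`ZMod` are represented by natural numbers below the size. -/
theorem componentParity_jump {e : P.Edge} {p w : Plane} (h : P.IsGeneric e p)
    (hw : cross (P.dir e) w ≠ 0) : ∀ᶠ t : ℝ in 𝓝[>] 0,
      P.componentParity e.1 (p + t • w) ≠ P.componentParity e.1 (p - t • w) := by
  obtain ⟨⟨s, h0, h1, rfl⟩, hu⟩ := h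
  obtain ⟨i, j⟩ := e
  obtain ⟨k, hk, rfl⟩ : ∃ k < P.size i, ((k : ℕ) : ZMod (P.size i)) = j :=
    ⟨j.val, ZMod.val_lt j, ZMod.natCast_zmod_val j⟩
  have hd : P.vertex i ((k + 1 : ℕ) : ZMod (P.size i)) - P.vertex i (k : ZMod (P.size i)) =
      P.dir ⟨i, (k : ZMod (P.size i))⟩ := by
    rw [dir, start, start, next, Nat.cast_succ]
  have key := planeParity_jump (V := fun l : ℕ => P.vertex i (l : ZMod (P.size i)))
    (m := P.size i) (i := k) (w := w) (exists_lt_vertex_eq i) (by simp) hk h0 h1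
    (by simp only [hd]; exact hw) ?_
  · simp only [hd] at key
    exact key
  · intro l hl hmem
    simp only [hd] at hmem
    rw [segment_vertex] at hmem
    have h2 := hu _ hmem
    simp only [Sigma.mk.injEq, heq_eq_eq, true_and] at h2
    rw [ZMod.natCast_eq_natCast_iff] at h2
    exact Nat.ModEq.eq_of_lt_of_lt h2 hl hk

/-- A function that is locally constant off the polygons is a function of the region. -/
theorem exists_region_function {g : Plane → ZMod 2}
    (hg : ∀ q ∉ P.support, ∀ᶠ q' in 𝓝 q, g q' = g q) :
    ∃ x : P.Region → ZMod 2, ∀ R : P.Region, ∀ q ∈ R.1, x R = g q := by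
  refine ⟨fun R => g R.nonempty.choose, fun R q hq => ?_⟩
  exact R.isPreconnected.eq_of_eventually_eq
    (fun q hq => hg q (Region.notMem_support hq)) R.nonempty.choose_spec hq

theorem zmodTwo_add_eq_one_iff {a b : ZMod 2} : a + b = 1 ↔ a ≠ b := by
  revert a b; decide

theorem zmodTwo_add_eq_zero_iff {a b : ZMod 2} : a + b = 0 ↔ a = b := by
  revert a b; decide

/-- The region functions given by the winding numbers of the polygons jump exactly across these. -/
theorem exists_windings : ∃ W : Fin n → P.Region → ZMod 2,
    ∀ (i : Fin n) (e : P.Edge) (p : Plane) (Q Q' : P.Region), P.IsGeneric e p →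
      P.Sides p Q Q' → W i Q + W i Q' = if e.1 = i then 1 else 0 := by
  choose W hW using fun i => exists_region_function (P := P) (g := P.componentParity i)
    fun q hq => eventually_componentParity_eq fun e _ he => hq (mem_support.mpr ⟨e, he⟩)
  refine ⟨W, fun i e p Q Q' he hs => ?_⟩
  split_ifs with hi
  · subst hi
    rw [zmodTwo_add_eq_one_iff]
    rcases ne_or_eq (P.dir e) 0 with hd | hd
    · obtain ⟨w, hw⟩ := exists_cross_ne_zero hd
      obtain ⟨T, T', h1, h2⟩ := IsRegular.exists_sides he hw
      have h3 := h2.self_of_nhds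
      rw [zero_smul, add_zero] at h3
      obtain ⟨t, ht1, ht2⟩ := (h1.and (componentParity_jump he hw)).exists
      rw [← hW _ _ _ ht1.1, ← hW _ _ _ ht1.2] at ht2
      rcases hs.unique h3 with ⟨rfl, rfl⟩ | ⟨rfl, rfl⟩
      · exact ht2
      · exact ht2.symm
    -- Regularity is not assumed here. With direction zero, `p` would be the start of `e`, which
    -- also lies on the preceding edge.
    · exfalso
      obtain ⟨⟨s, -, -, rfl⟩, hu⟩ := he
      rw [hd, smul_zero, add_zero] at hu
      obtain ⟨f, rfl⟩ := exists_next_eq e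
      exact next_ne _ (hu f (start_next_mem_seg f)).symm
  · rw [zmodTwo_add_eq_zero_iff]
    have hev := eventually_componentParity_eq (P := P) (i := i) (q := p) fun f hf hp =>
      hi (by rw [← hf, he.2 f hp])
    obtain ⟨q, hq, hqv⟩ := (mem_closure_iff_frequently.mp hs.1).and_eventually hev |>.exists
    obtain ⟨q', hq', hqv'⟩ := (mem_closure_iff_frequently.mp hs.2.1).and_eventually hev |>.exists
    rw [hW i Q q hq, hW i Q' q' hq', hqv, hqv']

theorem IsCrossing.mem_doublePoints {e f : P.Edge} {c : Plane} (h : P.IsCrossing e f c) :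
    c ∈ P.doublePoints :=
  ⟨e, f, h.ne, h.next_ne, h.next_ne', h.inner_left.mem_seg, h.inner_right.mem_seg⟩

/-- Converts a statement in the parameter along `e` into one about nearby points of the plane on
`e`; the affine coordinate along `e` recovers the parameter. -/
theorem eventually_of_isInner {e : P.Edge} {p : Plane} {T : Plane → Prop} (he : P.IsInner e p)
    (hd : P.dir e ≠ 0) (h : ∀ᶠ a : ℝ in 𝓝[≠] 0, T (p + a • P.dir e)) :
    ∀ᶠ q in 𝓝 p, q ≠ p → P.IsInner e q → T q := by
  obtain ⟨v, hv⟩ := exists_cross_ne_zero hd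
  have hc : Tendsto (fun q : Plane => cross (q - p) v / cross (P.dir e) v) (𝓝 p) (𝓝 0) := by
    have : ContinuousAt (fun q : Plane => cross (q - p) v / cross (P.dir e) v) p := by
      unfold cross
      fun_prop
    simpa [ContinuousAt, cross] using this
  filter_upwards [hc.eventually (eventually_nhdsWithin_iff.mp h)] with q hq hne hqe
  obtain ⟨s, -, -, rfl⟩ := hqe
  obtain ⟨t, -, -, rfl⟩ := he
  have e1 : P.start e + s • P.dir e - (P.start e + t • P.dir e) = (s - t) • P.dir e := by module
  have e2 : cross ((s - t) • P.dir e) v / cross (P.dir e) v = s - t := by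
    rw [div_eq_iff hv]
    simp [cross]
    ring
  rw [e1, e2] at hq
  have e3 : P.start e + t • P.dir e + (s - t) • P.dir e = P.start e + s • P.dir e := by module
  rw [e3] at hq
  refine hq ?_
  intro h0
  have h0 : s - t = 0 := h0
  rw [sub_eq_zero] at h0
  exact hne (by rw [h0])

theorem isPreconnected_setOf_isInner (e : P.Edge) : IsPreconnected {p | P.IsInner e p} := by
  have : {p | P.IsInner e p} = (fun s : ℝ => P.start e + s • P.dir e) '' Set.Ioo 0 1 := by
    ext p
    constructor
    · rintro ⟨s, h0, h1, rfl⟩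
      exact ⟨s, ⟨h0, h1⟩, rfl⟩
    · rintro ⟨s, ⟨h0, h1⟩, rfl⟩
      exact ⟨s, h0, h1, rfl⟩
  rw [this]
  exact isPreconnected_Ioo.image _ (by fun_prop)

theorem eventually_nhdsLT_of_neg {T : ℝ → Prop} (h : ∀ᶠ t : ℝ in 𝓝[>] 0, T (-t)) :
    ∀ᶠ a : ℝ in 𝓝[<] 0, T a := by
  have h1 : Tendsto (fun a : ℝ => -a) (𝓝[<] 0) (𝓝[>] 0) := by
    have := tendsto_neg_nhdsLT (a := (0 : ℝ))
    simpa using this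
  simpa using h1.eventually h

theorem IsCorners.sides_left {c u v : Plane} {A B C D : P.Region}
    (h : IsCorners P c u v A B C D) :
    ∀ᶠ a : ℝ in 𝓝[≠] 0, P.Sides (c + a • u) A B ∨ P.Sides (c + a • u) D C := by
  rw [← nhdsLT_sup_nhdsGT, eventually_sup]
  constructor
  · refine eventually_nhdsLT_of_neg (h.sides.mono fun t ht => Or.inr ?_)
    rw [neg_smul, ← sub_eq_add_neg]
    exact ht.2.1
  · exact h.sides.mono fun t ht => Or.inl ht.1

theorem IsCorners.sides_right {c u v : Plane} {A B C D : P.Region}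
    (h : IsCorners P c u v A B C D) :
    ∀ᶠ a : ℝ in 𝓝[≠] 0, P.Sides (c + a • v) A D ∨ P.Sides (c + a • v) B C := by
  rw [← nhdsLT_sup_nhdsGT, eventually_sup]
  constructor
  · refine eventually_nhdsLT_of_neg (h.sides.mono fun t ht => Or.inr ?_)
    rw [neg_smul, ← sub_eq_add_neg]
    exact ht.2.2.2
  · exact h.sides.mono fun t ht => Or.inl ht.2.2.1

theorem IsCorners.mem_closure {c u v : Plane} {A B C D : P.Region}
    (h : IsCorners P c u v A B C D) :
    c ∈ closure A.1 ∧ c ∈ closure B.1 ∧ c ∈ closure C.1 ∧ c ∈ closure D.1 := by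
  refine ⟨mem_closure_of_ray (h.ray.mono fun t ht => ht.1),
    mem_closure_of_ray (h.ray.mono fun t ht => ht.2.1),
    mem_closure_of_ray (w := -(u + v)) (h.ray.mono fun t ht => ?_),
    mem_closure_of_ray (w := -(u - v)) (h.ray.mono fun t ht => ?_)⟩
  · rw [smul_neg, ← sub_eq_add_neg]; exact ht.2.2.1
  · rw [smul_neg, ← sub_eq_add_neg]; exact ht.2.2.2

/-- The regions that have a crossing on their boundary are the regions at the four corners. -/
theorem IsCorners.mem_frontier_iff {c u v : Plane} {A B C D : P.Region}
    (h : IsCorners P c u v A B C D) (hc : c ∈ P.support) (R : P.Region) :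
    c ∈ frontier R.1 ↔ R = A ∨ R = B ∨ R = C ∨ R = D := by
  rw [frontier, R.isOpen.interior_eq]
  constructor
  · rintro ⟨h1, -⟩
    obtain ⟨q, hq, hq'⟩ :=
      (mem_closure_iff_frequently.mp h1).and_eventually h.eventually_mem |>.exists
    rcases hq' with hq' | hq' | hq' | hq' | hq'
    · exact absurd hq' (Region.notMem_support hq)
    · exact Or.inl (Region.eq_of_mem hq hq')
    · exact Or.inr (Or.inl (Region.eq_of_mem hq hq'))
    · exact Or.inr (Or.inr (Or.inl (Region.eq_of_mem hq hq')))
    · exact Or.inr (Or.inr (Or.inr (Region.eq_of_mem hq hq')))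
  · intro hR
    refine ⟨?_, fun hcR => Region.notMem_support hcR hc⟩
    obtain ⟨h1, h2, h3, h4⟩ := h.mem_closure
    rcases hR with rfl | rfl | rfl | rfl <;> assumption

/-! ### Finiteness of the regions; propagation of jumps -/

namespace IsRegular

variable (hP : P.IsRegular)

include hP

theorem frequently_isGeneric {e : P.Edge} {p : Plane} (h : P.IsInner e p) :
    ∃ᶠ q in 𝓝 p, P.IsGeneric e q := by
  rcases hP.isGeneric_or_isCrossing h with hg | ⟨f, hf⟩
  · exact fun hn => hn.self_of_nhds hg
  · have h1 := (hP.eventually_isGeneric_of_isCrossing hf).frequently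
    exact ((tendsto_ray p (P.dir e)).mono_left nhdsWithin_le_nhds).frequently h1

theorem exists_isGeneric (e : P.Edge) : ∃ p, P.IsGeneric e p :=
  (hP.frequently_isGeneric (e := e)
    ⟨1 / 2, by norm_num, by norm_num, rfl⟩).exists

theorem exists_sides_of_isGeneric {e : P.Edge} {p : Plane} (h : P.IsGeneric e p) :
    ∃ Q Q' : P.Region, ∀ᶠ a in 𝓝 (0 : ℝ), P.Sides (p + a • P.dir e) Q Q' := by
  obtain ⟨v, hv⟩ := exists_cross_ne_zero (hP.dir_ne_zero e)
  obtain ⟨Q, Q', -, h⟩ := exists_sides h hv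
  exact ⟨Q, Q', h⟩

theorem exists_sides_at {e : P.Edge} {p : Plane} (h : P.IsGeneric e p) :
    ∃ Q Q' : P.Region, P.Sides p Q Q' := by
  obtain ⟨Q, Q', h⟩ := hP.exists_sides_of_isGeneric h
  exact ⟨Q, Q', by simpa using h.self_of_nhds⟩

/-- Near a given point there are only finitely many regions. -/
theorem eventually_mem_finite (p : Plane) :
    ∃ F : Set P.Region, F.Finite ∧ ∀ᶠ q in 𝓝 p, ∀ R : P.Region, q ∈ R.1 → R ∈ F := by
  by_cases hp : p ∈ P.support
  · rcases hP.mem_support_cases hp with ⟨e, rfl⟩ | ⟨e, he⟩ | ⟨e, f, hef⟩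
    · obtain ⟨Q, Q', -, h⟩ := hP.exists_sides_vertex e
      refine ⟨{Q, Q'}, by simp, h.mono fun q hq R hR => ?_⟩
      rcases hq with hq | hq | hq
      · exact absurd hq (Region.notMem_support hR)
      · exact Or.inl (Region.eq_of_mem hR hq)
      · exact Or.inr (Region.eq_of_mem hR hq)
    · obtain ⟨Q, Q', h⟩ := hP.exists_sides_at he
      refine ⟨{Q, Q'}, by simp, h.2.2.mono fun q hq R hR => ?_⟩
      rcases hq with hq | hq | hq
      · exact absurd hq (Region.notMem_support hR)
      · exact Or.inl (Region.eq_of_mem hR hq)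
      · exact Or.inr (Region.eq_of_mem hR hq)
    · obtain ⟨A, B, C, D, h⟩ := hP.exists_corners hef
      refine ⟨{A, B, C, D}, by simp, h.eventually_mem.mono fun q hq R hR => ?_⟩
      rcases hq with hq | hq | hq | hq | hq
      · exact absurd hq (Region.notMem_support hR)
      · simp [Region.eq_of_mem hR hq]
      · simp [Region.eq_of_mem hR hq]
      · simp [Region.eq_of_mem hR hq]
      · simp [Region.eq_of_mem hR hq]
  · obtain ⟨S, hS⟩ := Region.exists_mem hp
    exact ⟨{S}, by simp, (S.isOpen.eventually_mem hS).mono fun q hq R hR =>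
      Region.eq_of_mem hR hq⟩

/-- A compact ball around the polygons is covered by finitely many neighbourhoods that each meet
finitely many regions, and every region meets the ball. -/
theorem finite_region : Finite P.Region := by
  obtain ⟨r, hr0, hr⟩ : ∃ r > 0, P.support ⊆ Metric.ball 0 r := by
    obtain ⟨r, hr⟩ := P.isCompact_support.isBounded.subset_ball 0
    exact ⟨max r 1, by positivity, hr.trans (Metric.ball_subset_ball (le_max_left _ _))⟩
  choose F hF hFe using hP.eventually_mem_finite
  obtain ⟨t, -, ht⟩ := (isCompact_closedBall (0 : Plane) r).elim_nhds_subcover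
    (fun p => {q | ∀ R : P.Region, q ∈ R.1 → R ∈ F p}) fun p _ => hFe p
  have hmeet : ∀ R : P.Region, ∃ q ∈ R.1, q ∈ Metric.closedBall (0 : Plane) r := by
    intro R
    by_contra! hR
    -- A region missing the ball has no limit points on the polygons, so it would be open and
    -- closed, hence the whole plane.
    have hclosed : IsClosed R.1 := by
      refine isClosed_of_closure_subset fun q hq => ?_
      by_cases hqs : q ∈ P.support
      · obtain ⟨y, hy, hyR⟩ := mem_closure_iff.mp hq _ Metric.isOpen_ball (hr hqs)
        exact absurd (Metric.ball_subset_closedBall hy) (hR y hyR)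
      · exact Region.mem_of_mem_closure hqs hq
    have huniv := (IsClopen.eq_univ ⟨hclosed, R.isOpen⟩ R.nonempty)
    exact hR 0 (huniv ▸ Set.mem_univ _) (by simp [hr0.le])
  have hfin : (⋃ p ∈ t, F p).Finite := t.finite_toSet.biUnion fun p _ => hF p
  refine Set.finite_univ_iff.mp (hfin.subset fun R _ => ?_)
  obtain ⟨q, hqR, hq⟩ := hmeet R
  obtain ⟨p, hp, hqp⟩ := Set.mem_iUnion₂.mp (ht hq)
  exact Set.mem_iUnion₂.mpr ⟨p, hp, hqp R hqR⟩

/-- A property of regions that is invariant under crossing edges is constant. -/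
theorem forall_region {Z : P.Region → Prop}
    (hZ : ∀ e p Q Q', P.IsGeneric e p → P.Sides p Q Q' → Z Q → Z Q') {R₀ : P.Region}
    (h₀ : Z R₀) (R : P.Region) : Z R := by
  -- Outside this finite set all points of the polygons are generic, and its complement in the plane
  -- is connected.
  set T : Set Plane := Set.range P.start ∪ P.doublePoints with hT
  have hTfin : T.Finite := (Set.finite_range _).union hP.finite_doublePoints
  have hTsub : T ⊆ P.support := by
    rintro p (⟨e, rfl⟩ | ⟨e, f, -, -, -, he, -⟩)
    · exact mem_support.mpr ⟨e, start_mem_seg_self e⟩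
    · exact mem_support.mpr ⟨e, he⟩
  have hrank : 1 < Module.rank ℝ Plane := by
    refine Module.lt_rank_of_lt_finrank ?_
    rw [finrank_euclideanSpace_fin]
    norm_num
  have hpre : IsPreconnected Tᶜ :=
    (hTfin.countable.isPathConnected_compl_of_one_lt_rank hrank).isConnected.isPreconnected
  have hmem : ∀ (R : P.Region) (q : Plane), q ∈ R.1 → q ∈ Tᶜ := fun R q hq h =>
    Region.notMem_support hq (hTsub h)
  have hloc : ∀ q ∈ Tᶜ, ∃ Q Q' : P.Region, q ∈ closure Q.1 ∧ (Z Q ↔ Z Q') ∧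
      ∀ᶠ q' in 𝓝 q, ∀ R : P.Region, q' ∈ R.1 → R = Q ∨ R = Q' := by
    intro q hq
    by_cases hqs : q ∈ P.support
    · rcases hP.mem_support_cases hqs with ⟨e, rfl⟩ | ⟨e, he⟩ | ⟨e, f, hef⟩
      · exact absurd (Or.inl ⟨_, rfl⟩) hq
      · obtain ⟨Q, Q', h⟩ := hP.exists_sides_at he
        refine ⟨Q, Q', h.1, ⟨hZ e q Q Q' he h, hZ e q Q' Q he h.symm⟩,
          h.2.2.mono fun q' hq' R hR => ?_⟩
        rcases hq' with hq' | hq' | hq'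
        · exact absurd hq' (Region.notMem_support hR)
        · exact Or.inl (Region.eq_of_mem hR hq')
        · exact Or.inr (Region.eq_of_mem hR hq')
      · exact absurd (Or.inr hef.mem_doublePoints) hq
    · obtain ⟨S, hS⟩ := Region.exists_mem hqs
      exact ⟨S, S, subset_closure hS, Iff.rfl, (S.isOpen.eventually_mem hS).mono fun q' hq' R hR =>
        Or.inl (Region.eq_of_mem hR hq')⟩
  refine (hpre.forall_or_forall (A := fun q => ∀ᶠ q' in 𝓝 q, ∀ R : P.Region, q' ∈ R.1 → Z R)
    (B := fun q => ∀ᶠ q' in 𝓝 q, ∀ R : P.Region, q' ∈ R.1 → ¬Z R) (fun r hr => hr.eventually_nhds)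
    (fun r hr => hr.eventually_nhds) ?_ ?_).elim (fun h => ?_) (fun h => ?_)
  · intro q hq
    obtain ⟨Q, Q', -, hQ, hev⟩ := hloc q hq
    by_cases hZQ : Z Q
    · left
      filter_upwards [hev] with q' hq' R hR
      rcases hq' R hR with rfl | rfl
      exacts [hZQ, hQ.mp hZQ]
    · right
      filter_upwards [hev] with q' hq' R hR
      rcases hq' R hR with rfl | rfl
      exacts [hZQ, fun h => hZQ (hQ.mpr h)]
  · intro q hq h1 h2
    obtain ⟨Q, -, hcl, -, -⟩ := hloc q hq
    obtain ⟨y, hy, h3, h4⟩ :=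
      (mem_closure_iff_frequently.mp hcl).and_eventually (h1.and h2) |>.exists
    exact h4 Q hy (h3 Q hy)
  · obtain ⟨q, hq⟩ := R.nonempty
    exact (h q (hmem R q hq)).self_of_nhds R hq
  · obtain ⟨q, hq⟩ := R₀.nonempty
    exact absurd h₀ ((h q (hmem R₀ q hq)).self_of_nhds R₀ hq)

omit hP in
theorem sides_eq_iff {x : P.Region → ZMod 2} {p : Plane} {Q Q' T T' : P.Region}
    (h : P.Sides p Q Q') (h' : P.Sides p T T') : x Q = x Q' ↔ x T = x T' := by
  rcases h.unique h' with ⟨rfl, rfl⟩ | ⟨rfl, rfl⟩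
  · rfl
  · exact eq_comm

/-- If the values of `x` at the four corners of every crossing sum up to zero, then `x` jumps
everywhere along an edge, or nowhere. -/
theorem forall_jump_or {x : P.Region → ZMod 2}
    (hx : ∀ c ∈ P.doublePoints, ∃ e f A B C D, P.IsCrossing e f c ∧
      IsCorners P c (P.dir e) (P.dir f) A B C D ∧ x A + x B + x C + x D = 0) (e : P.Edge) :
    (∀ p Q Q', P.IsGeneric e p → P.Sides p Q Q' → x Q = x Q') ∨
      ∀ p Q Q', P.IsGeneric e p → P.Sides p Q Q' → x Q ≠ x Q' := by
  have hsum : ∀ a b c d : ZMod 2, a + b + c + d = 0 → (a = b ↔ d = c) ∧ (a = d ↔ b = c) := by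
    decide
  refine ((isPreconnected_setOf_isInner e).forall_or_forall
    (A := fun p => ∀ᶠ q in 𝓝 p, P.IsGeneric e q → ∀ Q Q', P.Sides q Q Q' → x Q = x Q')
    (B := fun p => ∀ᶠ q in 𝓝 p, P.IsGeneric e q → ∀ Q Q', P.Sides q Q Q' → x Q ≠ x Q')
    (fun r hr => hr.eventually_nhds) (fun r hr => hr.eventually_nhds) ?_ ?_).elim (fun h => ?_) (fun h => ?_)
  · intro p hp
    -- `α` is the common truth value of "no jump" at the generic points of `e` near `p`.
    obtain ⟨α, hα⟩ : ∃ α : Prop, ∀ᶠ q in 𝓝 p, P.IsGeneric e q →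
        ∀ Q Q', P.Sides q Q Q' → (x Q = x Q' ↔ α) := by
      rcases hP.isGeneric_or_isCrossing hp with hg | ⟨f, hf⟩
      · obtain ⟨Q, Q', h1⟩ := hP.exists_sides_of_isGeneric hg
        refine ⟨x Q = x Q', ?_⟩
        filter_upwards [eventually_of_isInner (T := fun q => P.Sides q Q Q') hp (hP.dir_ne_zero e)
          (h1.filter_mono nhdsWithin_le_nhds)] with q hq hqe T T' hT
        by_cases hqp : q = p
        · subst hqp
          exact sides_eq_iff hT (by simpa using h1.self_of_nhds)
        · exact sides_eq_iff hT (hq hqp hqe.1)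
      -- At a crossing, the vanishing corner sum makes the jumps on the two halves of the strand
      -- equal. The edge `e` may be either of the two given strands.
      · obtain ⟨e', f', A, B, C, D, hcr, hco, h0⟩ := hx p hf.mem_doublePoints
        obtain ⟨s1, s2⟩ := hsum _ _ _ _ h0
        have hnp : ¬P.IsGeneric e p := fun hg => hf.ne (hg.2 f hf.inner_right.mem_seg).symm
        rcases hcr.eq_or_eq e hf.inner_left.mem_seg with rfl | rfl
        · refine ⟨x A = x B, ?_⟩
          filter_upwards [eventually_of_isInner (T := fun q => P.Sides q A B ∨ P.Sides q D C) hp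
            (hP.dir_ne_zero e) hco.sides_left]
            with q hq hqe T T' hT
          rcases hq (by rintro rfl; exact hnp hqe) hqe.1 with h2 | h2
          · exact sides_eq_iff hT h2
          · exact (sides_eq_iff hT h2).trans s1.symm
        · refine ⟨x A = x D, ?_⟩
          filter_upwards [eventually_of_isInner (T := fun q => P.Sides q A D ∨ P.Sides q B C) hp
            (hP.dir_ne_zero e) hco.sides_right]
            with q hq hqe T T' hT
          rcases hq (by rintro rfl; exact hnp hqe) hqe.1 with h2 | h2
          · exact sides_eq_iff hT h2
          · exact (sides_eq_iff hT h2).trans s2.symm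
    by_cases h : α
    · exact Or.inl (hα.mono fun q hq hqe Q Q' hQ => (hq hqe Q Q' hQ).mpr h)
    · exact Or.inr (hα.mono fun q hq hqe Q Q' hQ h' => h ((hq hqe Q Q' hQ).mp h'))
  · intro p hp h1 h2
    obtain ⟨q, hq, h3, h4⟩ := ((hP.frequently_isGeneric hp).and_eventually (h1.and h2)).exists
    obtain ⟨Q, Q', hQ⟩ := hP.exists_sides_at hq
    exact h4 hq Q Q' hQ (h3 hq Q Q' hQ)
  · exact Or.inl fun p Q Q' hp => (h p hp.1).self_of_nhds hp Q Q'
  · exact Or.inr fun p Q Q' hp => (h p hp.1).self_of_nhds hp Q Q'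

theorem eventually_isGeneric_vertex (e : P.Edge) : ∀ᶠ t : ℝ in 𝓝[>] 0,
    P.IsGeneric e (P.start (P.next e) - t • P.dir e) ∧
    P.IsGeneric (P.next e) (P.start (P.next e) + t • P.dir (P.next e)) := by
  have h1 := ((tendsto_ray (P.start (P.next e)) (-P.dir e)).mono_left
    nhdsWithin_le_nhds).eventually (P.eventually_mem_seg (P.start (P.next e))) (l₁ := 𝓝[>] 0)
  have h2 := ((tendsto_ray (P.start (P.next e)) (P.dir (P.next e))).mono_left
    nhdsWithin_le_nhds).eventually (P.eventually_mem_seg (P.start (P.next e))) (l₁ := 𝓝[>] 0)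
  filter_upwards [h1, h2, eventually_pos_lt one_pos] with t h3 h4 ht
  rw [smul_neg, ← sub_eq_add_neg] at h3
  constructor
  · have hi : P.IsInner e (P.start (P.next e) - t • P.dir e) := by
      refine ⟨1 - t, by linarith, by linarith, ?_⟩
      simp only [dir]; module
    rcases hP.isGeneric_or_isCrossing hi with h | ⟨f, h⟩
    · exact h
    · rcases hP.eq_or_eq_of_start_mem (h3 f h.inner_right.mem_seg) with rfl | rfl
      · exact absurd rfl h.ne
      · exact absurd rfl h.next_ne
  · have hi : P.IsInner (P.next e) (P.start (P.next e) + t • P.dir (P.next e)) :=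
      ⟨t, ht.1, ht.2, rfl⟩
    rcases hP.isGeneric_or_isCrossing hi with h | ⟨f, h⟩
    · exact h
    · rcases hP.eq_or_eq_of_start_mem (h4 f h.inner_right.mem_seg) with rfl | rfl
      · exact absurd rfl h.next_ne'
      · exact absurd rfl h.ne

/-- If the values of `x` at the four corners of every crossing sum up to zero, then `x` jumps
everywhere along a polygon, or nowhere. -/
theorem no_jump_of_no_jump {x : P.Region → ZMod 2}
    (hx : ∀ c ∈ P.doublePoints, ∃ e f A B C D, P.IsCrossing e f c ∧
      IsCorners P c (P.dir e) (P.dir f) A B C D ∧ x A + x B + x C + x D = 0)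
    {i : Fin n} {j : ZMod (P.size i)} {p : Plane} {Q Q' : P.Region} (hp : P.IsGeneric ⟨i, j⟩ p)
    (hQ : P.Sides p Q Q') (hxQ : x Q = x Q') (k : ZMod (P.size i)) :
    ∀ p Q Q', P.IsGeneric ⟨i, k⟩ p → P.Sides p Q Q' → x Q = x Q' := by
  have hstep : ∀ e : P.Edge, (∀ p Q Q', P.IsGeneric e p → P.Sides p Q Q' → x Q = x Q') →
      ∀ p Q Q', P.IsGeneric (P.next e) p → P.Sides p Q Q' → x Q = x Q' := by
    intro e he
    obtain ⟨T, T', h1, -⟩ := hP.exists_sides_vertex e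
    obtain ⟨t, h2, h3⟩ := (h1.and (hP.eventually_isGeneric_vertex e)).exists
    have h4 := he _ _ _ h3.1 h2.1
    exact (hP.forall_jump_or hx (P.next e)).resolve_right fun h => h _ _ _ h3.2 h2.2 h4
  have h0 := (hP.forall_jump_or hx ⟨i, j⟩).resolve_right fun h => h _ _ _ hp hQ hxQ
  -- Walking along the cyclic polygon, counted by a natural number, reaches every edge.
  have hall : ∀ l : ℕ, ∀ p Q Q', P.IsGeneric ⟨i, j + (l : ZMod (P.size i))⟩ p →
      P.Sides p Q Q' → x Q = x Q' := by
    intro l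
    induction l with
    | zero => simpa using h0
    | succ l ih =>
      have := hstep _ ih
      rwa [next, add_assoc, ← Nat.cast_succ] at this
  have hk := hall (k - j).val
  rwa [ZMod.natCast_zmod_val, add_sub_cancel] at hk

end IsRegular

end PolygonSystem

/-! ### Closed curves through a crossing and the cut-off function -/

/-- Two points of a connected open set are joined by a polygonal path in it. -/
theorem exists_polygonal_path {U : Set Plane} (hU : IsOpen U) (hc : IsPreconnected U) {a b : Plane}
    (ha : a ∈ U) (hb : b ∈ U) : ∃ (m : ℕ) (z : ℕ → Plane), z 0 = a ∧ z m = b ∧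
      ∀ j < m, segment ℝ (z j) (z (j + 1)) ⊆ U := by
  set T : Plane → Prop := fun q => ∃ (m : ℕ) (z : ℕ → Plane), z 0 = a ∧ z m = q ∧
      ∀ j < m, segment ℝ (z j) (z (j + 1)) ⊆ U with hT
  have hstep : ∀ q q', T q → segment ℝ q q' ⊆ U → T q' := by
    rintro q q' ⟨m, z, h0, hm, hz⟩ hs
    refine ⟨m + 1, fun j => if j ≤ m then z j else q', by simp [h0], by simp, fun j hj => ?_⟩
    rcases (Nat.lt_succ_iff.mp hj).eq_or_lt with rfl | hj
    · simpa [hm] using hs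
    · simpa [hj.le, Nat.succ_le_iff.mpr hj] using hz j hj
  -- Balls are convex, so being reachable is locally constant on `U`.
  have hball : ∀ q ∈ U, ∀ᶠ q' in 𝓝 q, q' ∈ U ∧ (T q ↔ T q') := by
    intro q hq
    obtain ⟨r, hr, hrU⟩ := Metric.isOpen_iff.mp hU q hq
    filter_upwards [Metric.ball_mem_nhds q hr] with q' hq'
    have hs : segment ℝ q q' ⊆ U :=
      ((convex_ball q r).segment_subset (Metric.mem_ball_self hr) hq').trans hrU
    exact ⟨hrU hq', fun h => hstep _ _ h hs, fun h => hstep _ _ h (segment_symm ℝ q q' ▸ hs)⟩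
  rcases hc.forall_or_forall (A := fun q => q ∈ U ∧ T q) (B := fun q => q ∈ U ∧ ¬T q)
    (fun q hq => (hball q hq.1).mono fun q' h => ⟨h.1, h.2.mp hq.2⟩)
    (fun q hq => (hball q hq.1).mono fun q' h => ⟨h.1, fun h' => hq.2 (h.2.mpr h')⟩)
    (fun q hq => (em (T q)).imp (fun h => ⟨hq, h⟩) fun h => ⟨hq, h⟩)
    (fun q hq h h' => h'.2 h.2) with h | h
  · exact (h b hb).2
  · exact absurd ⟨0, fun _ => a, rfl, rfl, by simp⟩ (h a ha).2

/-- If a line through `c` runs in the connected open set `U` on both sides of `c`, then a closed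
polygon in `U ∪ {c}` separates the two sides of this line at `c`. -/
theorem exists_separating_function {U : Set Plane} (hU : IsOpen U) (hc : IsPreconnected U)
    {c w : Plane} (hcU : c ∉ U) (h : ∀ᶠ t : ℝ in 𝓝[>] 0, c + t • w ∈ U ∧ c - t • w ∈ U) :
    ∃ g : Plane → ZMod 2, (∀ q ∉ U, q ≠ c → ∀ᶠ q' in 𝓝 q, g q' = g q) ∧
      ∀ v, cross w v ≠ 0 → ∀ᶠ t : ℝ in 𝓝[>] 0, g (c + t • v) ≠ g (c - t • v) := by
  obtain ⟨ε₀, hε₀, hε⟩ := mem_nhdsGT_iff_exists_Ioo_subset.mp h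
  have hε₀ : 0 < ε₀ := hε₀
  set ε := ε₀ / 2 with hεdef
  have hε0 : 0 < ε := by positivity
  have hmem : ∀ t : ℝ, 0 < t → t ≤ ε → c + t • w ∈ U ∧ c - t • w ∈ U := fun t h0 h1 =>
    hε ⟨h0, by linarith⟩
  obtain ⟨m, z, hz0, hzm, hz⟩ := exists_polygonal_path hU hc (hmem ε hε0 le_rfl).1
    (hmem ε hε0 le_rfl).2
  -- The path in `U` from `c + ε • w` to `c - ε • w` is closed up by its last edge, with index `m`,
  -- whose midpoint is `c`. All its other edges miss `c`.
  set V : ℕ → Plane := fun j => if j ≤ m then z j else z 0 with hV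
  have hV0 : V 0 = c + ε • w := by simp [hV, hz0]
  have hVm : V m = c - ε • w := by simp [hV, hzm]
  have hVm1 : V (m + 1) = c + ε • w := by simp [hV, hz0]
  have hVz : ∀ j < m, segment ℝ (V j) (V (j + 1)) ⊆ U := by
    intro j hj
    simpa [hV, hj.le, Nat.succ_le_iff.mpr hj] using hz j hj
  have hVV : ∀ j, ∃ k < m + 1, V j = V k := by
    intro j
    by_cases hj : j ≤ m
    · exact ⟨j, by omega, rfl⟩
    · exact ⟨0, by omega, by simp [hV, hj]⟩
  have hd : V (m + 1) - V m = (2 * ε) • w := by rw [hVm, hVm1]; module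
  have hmid : V m + (1 / 2 : ℝ) • (V (m + 1) - V m) = c := by rw [hd, hVm]; module
  refine ⟨planeParity V (m + 1), fun q hq hqc => ?_, fun v hv => ?_⟩
  · refine eventually_planeParity_eq hVV (hVm1.trans hV0.symm) fun j hj hqj => ?_
    rcases (Nat.lt_succ_iff.mp hj).eq_or_lt with rfl | hj
    · rw [segment_eq_image'] at hqj
      obtain ⟨s, ⟨hs0, hs1⟩, rfl⟩ := hqj
      have he : V j + s • (V (j + 1) - V j) = c + (ε * (2 * s - 1)) • w := by
        rw [hd, hVm]; module
      simp only [he] at hq hqc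
      rcases lt_trichotomy (2 * s - 1) 0 with h1 | h1 | h1
      · have := (hmem (ε * (1 - 2 * s)) (mul_pos hε0 (by linarith)) (by nlinarith)).2
        apply hq
        convert this using 1
        module
      · exact hqc (by rw [h1]; simp)
      · exact hq (hmem _ (mul_pos hε0 h1) (by nlinarith)).1
    · exact hq (hVz j hj hqj)
  · have := planeParity_jump (V := V) (m := m + 1) (i := m) (w := v) (s := 1 / 2) hVV
      (hVm1.trans hV0.symm) (by omega) (by norm_num) (by norm_num) ?_ ?_
    · rwa [hmid] at this
    · rw [hd]
      have : cross ((2 * ε) • w) v = 2 * ε * cross w v := by simp [cross]; ring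
      rw [this]
      exact mul_ne_zero (by positivity) hv
    · intro j hj hcj
      rw [hmid] at hcj
      by_contra hjm
      exact hcU (hVz j (by omega) hcj)

namespace PolygonSystem

variable {n : ℕ} {P : PolygonSystem n}

/-- This reduces the case that `B` and `D` coincide to the case that `A` and `C` do. -/
theorem IsCorners.reflect {c u v : Plane} {A B C D : P.Region}
    (h : IsCorners P c u v A B C D) : IsCorners P c u (-v) B A D C := by
  refine ⟨?_, h.eventually_mem.mono ?_, h.ray.mono ?_, h.sides.mono ?_⟩
  · have : cross u (-v) = -cross u v := by simp [cross]; ring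
    rw [this, neg_ne_zero]
    exact h.cross_ne
  · tauto
  · intro t ht
    rw [← sub_eq_add_neg, sub_neg_eq_add]
    exact ⟨ht.2.1, ht.1, ht.2.2.2, ht.2.2.1⟩
  · intro t ht
    rw [smul_neg, ← sub_eq_add_neg, sub_neg_eq_add]
    exact ⟨ht.1.symm, ht.2.1.symm, ht.2.2.2, ht.2.2.1⟩

/-- At a reducible crossing `c`, where the region `A` occupies two opposite corners, a function `y`
can be cut off along a closed curve in `A ∪ {c}`. -/
theorem IsCorners.exists_cut {c u v : Plane} {A B D : P.Region}
    (hc : IsCorners P c u v A B A D) (hcs : c ∈ P.support) (y : P.Region → ZMod 2)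
    (hB : y A ≠ y B) (hD : y A ≠ y D) (R₀ : P.Region) :
    ∃ (S : Set P.Region) (w : P.Region → ZMod 2), (∀ X, w X ≠ 0 → X ∈ S) ∧ A ∉ S ∧ R₀ ∉ S ∧
      (∀ p X Y, p ∈ P.support → p ≠ c → P.Sides p X Y → Y ∈ S → X ∈ S ∨ X = A) ∧
      w A + w B + w A + w D = 1 ∧
      ∀ c' u' v' A' B' C' D', c' ∈ P.support → c' ≠ c → IsCorners P c' u' v' A' B' C' D' →
        y A' + y B' + y C' + y D' = 0 → w A' + w B' + w C' + w D' = 0 := by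
  classical
  have hcA : c ∉ A.1 := fun h => Region.notMem_support h hcs
  obtain ⟨g, hg, hjump⟩ := exists_separating_function A.isOpen A.isPreconnected hcA
    (w := u + v) (hc.ray.mono fun t ht => ⟨ht.1, ht.2.2.1⟩)
  -- At `c` the curve leaves into the two corners of `A` along `±(u + v)`; the transverse direction
  -- `u - v` leads from `D` to `B`.
  have hcr : cross (u + v) (u - v) ≠ 0 := by
    have : cross (u + v) (u - v) = -2 * cross u v := by simp [cross]; ring
    rw [this]
    exact mul_ne_zero (by norm_num) hc.cross_ne
  have hdisj : ∀ X : P.Region, X ≠ A → ∀ q ∈ X.1, q ∉ A.1 := fun X hX q hq hqA =>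
    hX (Region.eq_of_mem hq hqA)
  have hconst : ∀ X : P.Region, X ≠ A → ∀ q ∈ X.1, ∀ q' ∈ X.1, g q = g q' := fun X hX q hq q' hq' =>
    X.isPreconnected.eq_of_eventually_eq (fun r hr => hg r (hdisj X hX r hr)
      (by rintro rfl; exact Region.notMem_support hr hcs)) hq hq'
  set G : P.Region → ZMod 2 := fun X => g X.nonempty.choose with hG
  have hGX : ∀ X : P.Region, X ≠ A → ∀ q ∈ X.1, g q = G X := fun X hX q hq =>
    hconst X hX q hq _ X.nonempty.choose_spec
  have hBA : B ≠ A := by rintro rfl; exact hB rfl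
  have hDA : D ≠ A := by rintro rfl; exact hD rfl
  have hBD : G B ≠ G D := by
    obtain ⟨t, h1, h2⟩ := ((hjump _ hcr).and hc.ray).exists
    rwa [hGX B hBA _ h2.2.1, hGX D hDA _ h2.2.2.2] at h1
  have hclos : ∀ p ∈ P.support, p ≠ c → ∀ X : P.Region, X ≠ A → p ∈ closure X.1 → G X = g p := by
    intro p hp hpc X hX hpX
    obtain ⟨q, hq, hq'⟩ := (mem_closure_iff_frequently.mp hpX).and_eventually
      (hg p (fun h => Region.notMem_support h hp) hpc) |>.exists
    rw [← hGX X hX q hq, hq']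
  -- `β` marks the side of the curve that does not contain `R₀`. Exactly one of `B` and `D` lies on
  -- the side `β`.
  obtain ⟨β, hβ, hR₀⟩ : ∃ β, (G B = β ∧ G D ≠ β ∨ G B ≠ β ∧ G D = β) ∧ G R₀ ≠ β := by
    by_cases h : G R₀ = G B
    · exact ⟨G D, Or.inr ⟨hBD, rfl⟩, h ▸ hBD⟩
    · exact ⟨G B, Or.inl ⟨rfl, hBD.symm⟩, h⟩
  -- Adding `y A` makes the function vanish on `A`, the region in which the curve runs; hence
  -- cutting it off along the curve does no harm at other crossings.
  have two : ∀ a b : ZMod 2, a ≠ b → b + a = 1 := by decide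
  set w : P.Region → ZMod 2 := fun X => if X ≠ A ∧ G X = β then y X + y A else 0 with hw
  have hwA : w A = 0 := by simp [hw]
  refine ⟨{X | X ≠ A ∧ G X = β}, w, ?_, ?_, ?_, ?_, ?_, ?_⟩
  · intro X hX
    by_contra h
    exact hX (if_neg h)
  · exact fun h => h.1 rfl
  · exact fun h => hR₀ h.2
  · intro p X Y hp hpc hs hY
    by_cases hX : X = A
    · exact Or.inr hX
    · refine Or.inl ⟨hX, ?_⟩
      rw [hclos p hp hpc X hX hs.1, ← hclos p hp hpc Y hY.1 hs.2.1]
      exact hY.2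
  · rw [hwA]
    rcases hβ with ⟨h1, h2⟩ | ⟨h1, h2⟩
    · simp [hw, hBA, h1, h2, two _ _ hB]
    · simp [hw, hDA, h1, h2, two _ _ hD]
  · intro c' u' v' A' B' C' D' hc's hc'c hc' hy
    obtain ⟨hA', hB', hC', hD'⟩ := hc'.mem_closure
    -- Away from `c` all regions at a crossing, except possibly `A`, lie on the same side. There `w`
    -- is either `y + y A` throughout, `A` included, or zero throughout.
    by_cases hb : g c' = β
    · have hwX : ∀ X : P.Region, c' ∈ closure X.1 → w X = y X + y A := by
        intro X hX
        by_cases hXA : X = A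
        · rw [hXA, hwA, CharTwo.add_self_eq_zero]
        · exact if_pos ⟨hXA, (hclos c' hc's hc'c X hXA hX).trans hb⟩
      rw [hwX _ hA', hwX _ hB', hwX _ hC', hwX _ hD']
      have four : ∀ a b c d e : ZMod 2, a + b + c + d = 0 →
          a + e + (b + e) + (c + e) + (d + e) = 0 := by decide
      exact four _ _ _ _ _ hy
    · have hwX : ∀ X : P.Region, c' ∈ closure X.1 → w X = 0 := by
        intro X hX
        refine if_neg ?_
        rintro ⟨hXA, hXb⟩
        exact hb ((hclos c' hc's hc'c X hXA hX).symm.trans hXb)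
      rw [hwX _ hA', hwX _ hB', hwX _ hC', hwX _ hD']
      simp

namespace IsRegular

variable (hP : P.IsRegular)

include hP

/-- Each of the four half-strands at `c` has generic points arbitrarily near `c`, where `hW`
applies. -/
theorem jumps_at_corners {e f : P.Edge} {c : Plane} {A B C D : P.Region}
    (hc : P.IsCrossing e f c) (h : IsCorners P c (P.dir e) (P.dir f) A B C D)
    {W : P.Region → ZMod 2} {α : P.Edge → ZMod 2}
    (hW : ∀ e p Q Q', P.IsGeneric e p → P.Sides p Q Q' → W Q + W Q' = α e) :
    W A + W B = α e ∧ W D + W C = α e ∧ W A + W D = α f ∧ W B + W C = α f := by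
  have hneg : Tendsto (fun t : ℝ => -t) (𝓝[>] 0) (𝓝[≠] 0) := by
    have := tendsto_neg_nhdsGT (a := (0 : ℝ))
    rw [neg_zero] at this
    exact this.mono_right (nhdsWithin_mono _ fun x hx => ne_of_lt hx)
  have hpos : Tendsto (fun t : ℝ => t) (𝓝[>] 0) (𝓝[≠] 0) :=
    tendsto_id.mono_right (nhdsWithin_mono _ fun x hx => ne_of_gt hx)
  have he := hP.eventually_isGeneric_of_isCrossing hc
  have hf := hP.eventually_isGeneric_of_isCrossing hc.symm
  obtain ⟨t, h1, h2, h3, h4, h5⟩ := (h.sides.and ((hpos.eventually he).and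
    ((hneg.eventually he).and ((hpos.eventually hf).and (hneg.eventually hf))))).exists
  rw [neg_smul, ← sub_eq_add_neg] at h3 h5
  exact ⟨hW _ _ _ _ h2 h1.1, hW _ _ _ _ h3 h1.2.1, hW _ _ _ _ h4 h1.2.2.1, hW _ _ _ _ h5 h1.2.2.2⟩

end IsRegular

end PolygonSystem

/-! ### Linear algebra: the kernel of the corner sums and the correction at reducible crossings -/

namespace PolygonSystem

variable {n : ℕ} {P : PolygonSystem n}

/-- A choice of the two edges and of the regions at the four corners of every crossing. -/
structure CornerData (P : PolygonSystem n) where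
  /-- an edge through the crossing -/
  left : P.doublePoints → P.Edge
  /-- the other edge through the crossing -/
  right : P.doublePoints → P.Edge
  /-- the region in front of both edges -/
  A : P.doublePoints → P.Region
  /-- the region in front of the left edge and behind the right edge -/
  B : P.doublePoints → P.Region
  /-- the region behind both edges -/
  C : P.doublePoints → P.Region
  /-- the region behind the left edge and in front of the right edge -/
  D : P.doublePoints → P.Region
  isCrossing : ∀ c : P.doublePoints, P.IsCrossing (left c) (right c) c
  isCorners : ∀ c : P.doublePoints, IsCorners P c (P.dir (left c)) (P.dir (right c)) (A c) (B c) (C c) (D c)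

theorem IsRegular.nonempty_cornerData (hP : P.IsRegular) : Nonempty (CornerData P) := by
  choose e f h using fun c : P.doublePoints => hP.exists_isCrossing c.2
  choose A B C D h' using fun c => hP.exists_corners (h c)
  exact ⟨⟨e, f, A, B, C, D, h, h'⟩⟩

theorem mem_support_of_mem_doublePoints {c : Plane} (h : c ∈ P.doublePoints) : c ∈ P.support := by
  obtain ⟨e, f, -, -, -, he, -⟩ := h
  exact mem_support.mpr ⟨e, he⟩

instance instNonemptyRegion : Nonempty P.Region := by
  obtain ⟨q, hq⟩ := Set.nonempty_compl.mpr P.isCompact_support.ne_univ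
  exact ⟨(Region.exists_mem hq).choose⟩

namespace CornerData

variable (K : CornerData P)

/-- The sum of the values at the four corners of a crossing. -/
def cornerSum : (P.Region → ZMod 2) →ₗ[ZMod 2] (P.doublePoints → ZMod 2) where
  toFun x c := x (K.A c) + x (K.B c) + x (K.C c) + x (K.D c)
  map_add' x y := by ext c; simp only [Pi.add_apply]; ring
  map_smul' r x := by
    ext c; simp only [Pi.smul_apply, smul_eq_mul, RingHom.id_apply]; ring

theorem cornerSum_apply (x : P.Region → ZMod 2) (c : P.doublePoints) :
    K.cornerSum x c = x (K.A c) + x (K.B c) + x (K.C c) + x (K.D c) := rfl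

variable (hP : P.IsRegular)

include hP

/-- The corners pair up across the left strand, and both pairs contribute the same jump. -/
theorem cornerSum_winding {W : P.Region → ZMod 2} {α : P.Edge → ZMod 2}
    (hW : ∀ e p Q Q', P.IsGeneric e p → P.Sides p Q Q' → W Q + W Q' = α e) :
    K.cornerSum W = 0 := by
  ext c
  obtain ⟨h1, h2, -, -⟩ := hP.jumps_at_corners (K.isCrossing c) (K.isCorners c) hW
  rw [cornerSum_apply, h1, add_assoc, add_comm (W (K.C c)), h2, CharTwo.add_self_eq_zero]
  rfl

theorem finrank_ker_cornerSum : Module.finrank (ZMod 2) (LinearMap.ker K.cornerSum) = n + 1 := by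
  classical
  obtain ⟨W, hW⟩ := exists_windings (P := P)
  choose p hp using fun i => hP.exists_isGeneric (⟨i, 0⟩ : P.Edge)
  choose Q Q' hQ using fun i => hP.exists_sides_at (hp i)
  let Φ : (ZMod 2 × (Fin n → ZMod 2)) →ₗ[ZMod 2] (P.Region → ZMod 2) :=
    { toFun := fun a R => a.1 + ∑ i, a.2 i * W i R
      map_add' := by
        intro a b
        ext R
        simp only [Prod.fst_add, Prod.snd_add, Pi.add_apply, add_mul, Finset.sum_add_distrib]
        ring
      map_smul' := by
        intro r a
        ext R
        simp [mul_add, Finset.mul_sum, mul_assoc] }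
  have hΦ : ∀ a R, Φ a R = a.1 + ∑ i, a.2 i * W i R := fun _ _ => rfl
  have hjump : ∀ a e p Q Q', P.IsGeneric e p → P.Sides p Q Q' →
      Φ a Q + Φ a Q' = a.2 e.1 := by
    intro a e p Q Q' he hs
    have h1 : Φ a Q + Φ a Q' = (a.1 + a.1) + ∑ i, a.2 i * (W i Q + W i Q') := by
      simp only [hΦ, mul_add, Finset.sum_add_distrib]
      ring
    rw [h1, CharTwo.add_self_eq_zero, zero_add]
    simp [hW _ e p Q Q' he hs]
  have hinj : Function.Injective Φ := by
    rw [← LinearMap.ker_eq_bot, LinearMap.ker_eq_bot']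
    intro a ha
    -- The coefficient of `W i` is the jump of `Φ a` at the reference point on the `i`-th polygon;
    -- then only the constant is left.
    have h2 : a.2 = 0 := by
      ext i
      have := hjump a _ _ _ _ (hp i) (hQ i)
      simp only [ha, Pi.zero_apply, add_zero] at this
      exact this.symm
    obtain ⟨R⟩ : Nonempty P.Region := inferInstance
    have h1 := hΦ a R
    rw [ha, h2] at h1
    simp only [Pi.zero_apply, zero_mul, Finset.sum_const_zero, add_zero] at h1
    exact Prod.ext h1.symm h2
  have hrange : LinearMap.range Φ = LinearMap.ker K.cornerSum := by
    apply le_antisymm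
    · rintro _ ⟨a, rfl⟩
      exact K.cornerSum_winding hP (hjump a)
    · intro x hx
      rw [LinearMap.mem_ker] at hx
      -- The coefficients are the jumps of `x` at the reference points, so `y` has no jump there,
      -- hence none along any polygon.
      set a : Fin n → ZMod 2 := fun i => x (Q i) + x (Q' i) with ha
      set y := x + Φ (0, a) with hy
      have hy0 : K.cornerSum y = 0 := by
        rw [hy, map_add, hx, K.cornerSum_winding hP (hjump (0, a)), add_zero]
      have hyc : ∀ c ∈ P.doublePoints, ∃ e f A B C D, P.IsCrossing e f c ∧
          IsCorners P c (P.dir e) (P.dir f) A B C D ∧ y A + y B + y C + y D = 0 :=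
        fun c hc => ⟨_, _, _, _, _, _, K.isCrossing ⟨c, hc⟩, K.isCorners ⟨c, hc⟩,
          congrFun hy0 ⟨c, hc⟩⟩
      have hyj : ∀ i, y (Q i) = y (Q' i) := by
        intro i
        have h1 := hjump (0, a) _ _ _ _ (hp i) (hQ i)
        rw [← zmodTwo_add_eq_zero_iff]
        have h2 : y (Q i) + y (Q' i) = a i + (Φ (0, a) (Q i) + Φ (0, a) (Q' i)) := by
          simp only [hy, ha, Pi.add_apply]
          ring
        rw [h2, h1, CharTwo.add_self_eq_zero]
      obtain ⟨R₀⟩ : Nonempty P.Region := inferInstance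
      have hconst : ∀ R, y R = y R₀ := by
        refine hP.forall_region (Z := fun R => y R = y R₀) ?_ rfl
        rintro ⟨i, j⟩ q T T' hq hT hTy
        rw [← hTy]
        exact (hP.no_jump_of_no_jump hyc (hp i) (hQ i) (hyj i) j q T T' hq hT).symm
      refine ⟨(y R₀, a), ?_⟩
      ext R
      have h1 := hconst R
      change x R + Φ (0, a) R = y R₀ at h1
      rw [hΦ] at h1
      rw [hΦ, ← h1]
      simp only [zero_add]
      rw [add_assoc, CharTwo.add_self_eq_zero, add_zero]
  rw [← hrange, LinearMap.finrank_range_of_inj hinj]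
  simp [Module.finrank_prod, add_comm]

/-- At a crossing, the sum over the incident regions, each of them counted once, differs from the
sum over the four corners by a function that can be corrected at this crossing alone. -/
theorem exists_correction [Fintype P.Region] (R₀ : P.Region) (c : P.doublePoints) :
    ∃ (S : Set P.Region) (w : P.Region → ZMod 2) (ε : ZMod 2) (A : P.Region),
      (∀ X, w X ≠ 0 → X ∈ S) ∧ R₀ ∉ S ∧
      (∀ e p X Y, P.IsGeneric e p → P.Sides p X Y → Y ∈ S → X ∈ S ∨ X = A) ∧
      K.cornerSum w c = ε ∧ (∀ c', c' ≠ c → K.cornerSum w c' = 0) ∧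
      ∀ x : P.Region → ZMod 2, (∑ R ∈ {R | R = K.A c ∨ R = K.B c ∨ R = K.C c ∨ R = K.D c}, x R) =
        K.cornerSum x c + ε * x A := by
  classical
  obtain ⟨W, hW⟩ := exists_windings (P := P)
  have hcs := mem_support_of_mem_doublePoints c.2
  have hjump := fun i => hP.jumps_at_corners (K.isCrossing c) (K.isCorners c) (hW i)
  obtain ⟨h1, h2, -, -⟩ := hjump (K.left c).1
  obtain ⟨-, -, h3, h4⟩ := hjump (K.right c).1
  rw [if_pos rfl, zmodTwo_add_eq_one_iff] at h1 h2 h3 h4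
  have hgen : ∀ e p, P.IsGeneric e p → p ≠ c := by
    rintro e p he rfl
    have e1 := he.2 _ (K.isCrossing c).inner_left.mem_seg
    have e2 := he.2 _ (K.isCrossing c).inner_right.mem_seg
    exact (K.isCrossing c).ne (e1.trans e2.symm)
  have hgs : ∀ e p, P.IsGeneric e p → p ∈ P.support := fun e p he =>
    mem_support.mpr ⟨e, he.1.mem_seg⟩
  -- Adjacent corners are distinct, since the winding parity of the strand between them separates
  -- them. Only opposite corners can coincide.
  have hAB : K.A c ≠ K.B c := fun h => h1 (by rw [h])
  have hDC : K.D c ≠ K.C c := fun h => h2 (by rw [h])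
  have hAD : K.A c ≠ K.D c := fun h => h3 (by rw [h])
  have hBC : K.B c ≠ K.C c := fun h => h4 (by rw [h])
  have hset : ({R | R = K.A c ∨ R = K.B c ∨ R = K.C c ∨ R = K.D c} : Finset P.Region) =
      {K.A c, K.B c, K.C c, K.D c} := by
    ext; simp
  have hWcorner : ∀ c', W (K.left c).1 (K.A c') + W (K.left c).1 (K.B c') +
      W (K.left c).1 (K.C c') + W (K.left c).1 (K.D c') = 0 := fun c' =>
    congrFun (K.cornerSum_winding hP (hW (K.left c).1)) c'
  have hmem := fun c' (hc' : c' ≠ c) => mem_support_of_mem_doublePoints (P := P) (c := c'.1) c'.2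
  have hval : ∀ c', c' ≠ c → (c' : Plane) ≠ c := fun c' hc' h => hc' (Subtype.ext h)
  by_cases hAC : K.A c = K.C c
  · have hc := K.isCorners c
    rw [← hAC] at hc h2
    obtain ⟨S, w, i1, i2, i3, i4, i5, i6⟩ := hc.exists_cut hcs (W (K.left c).1) h1 h2.symm R₀
    -- Both opposite pairs cannot coincide, as the corner sum of `w` at `c` would then be 0 instead
    -- of 1.
    have hBD : K.B c ≠ K.D c := by
      intro h
      rw [← h] at i5
      have : ∀ s t : ZMod 2, s + t + s + t ≠ 1 := by decide
      exact this _ _ i5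
    refine ⟨S, w, 1, K.A c, i1, i3, fun e p X Y he => i4 p X Y (hgs e p he) (hgen e p he), ?_,
      fun c' hc' => i6 _ _ _ _ _ _ _ (hmem c' hc') (hval c' hc') (K.isCorners c') (hWcorner c'),
      fun x => ?_⟩
    · rw [cornerSum_apply, ← hAC, i5]
    · have hs : ({K.A c, K.B c, K.C c, K.D c} : Finset P.Region) = {K.A c, K.B c, K.D c} := by
        rw [← hAC]; ext; simp; tauto
      rw [hset, hs, cornerSum_apply, ← hAC, Finset.sum_insert (by simp [hAB, hAD]),
        Finset.sum_insert (by simp [hBD]), Finset.sum_singleton]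
      have : ∀ a b d : ZMod 2, a + (b + d) = a + b + a + d + 1 * a := by decide
      exact this _ _ _
  by_cases hBD : K.B c = K.D c
  · have hc := (K.isCorners c).reflect
    rw [← hBD] at hc h2
    obtain ⟨S, w, i1, i2, i3, i4, i5, i6⟩ := hc.exists_cut hcs (W (K.left c).1) h1.symm h2 R₀
    refine ⟨S, w, 1, K.B c, i1, i3, fun e p X Y he => i4 p X Y (hgs e p he) (hgen e p he), ?_,
      fun c' hc' => i6 _ _ _ _ _ _ _ (hmem c' hc') (hval c' hc') (K.isCorners c') (hWcorner c'),
      fun x => ?_⟩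
    · rw [cornerSum_apply, ← hBD, ← i5]
      ring
    · have hs : ({K.A c, K.B c, K.C c, K.D c} : Finset P.Region) = {K.A c, K.B c, K.C c} := by
        rw [← hBD]; ext; simp; tauto
      rw [hset, hs, cornerSum_apply, ← hBD, Finset.sum_insert (by simp [hAB, hAC]),
        Finset.sum_insert (by simp [hBC]), Finset.sum_singleton]
      have : ∀ a b d : ZMod 2, a + (b + d) = a + b + d + b + 1 * b := by decide
      exact this _ _ _
  -- With four distinct corners no correction is needed; `K.A c` is an arbitrary choice.
  · refine ⟨∅, 0, 0, K.A c, by simp, by simp, by simp, by simp [cornerSum_apply],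
      by simp [cornerSum_apply], fun x => ?_⟩
    rw [hset, cornerSum_apply, Finset.sum_insert (by simp [hAB, hAC, hAD]),
      Finset.sum_insert (by simp [hBC, hBD]), Finset.sum_insert (by simp [hDC.symm]),
      Finset.sum_singleton]
    ring

include K in
/-- The matrix of incidences between regions and crossings has corank one plus the number of
polygons. -/
theorem rank_incidence [Fintype P.Region] [Fintype P.doublePoints]
    (M : Matrix P.Region P.doublePoints (ZMod 2))
    (hM : ∀ R c, M R c = open Classical in if (c : Plane) ∈ frontier R.1 then 1 else 0) :
    M.rank + (n + 1) = Fintype.card P.Region := by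
  classical
  obtain ⟨R₀⟩ : Nonempty P.Region := inferInstance
  choose S w ε A hwS hRS hadj hself hother hsum using K.exists_correction hP R₀
  let N : (P.Region → ZMod 2) →ₗ[ZMod 2] (P.Region → ZMod 2) :=
    { toFun := fun x => x + ∑ c, x (A c) • w c
      map_add' := by
        intro x y
        simp only [Pi.add_apply, add_smul, Finset.sum_add_distrib]
        abel
      map_smul' := by
        intro r x
        simp [Finset.smul_sum, mul_smul] }
  have hN : ∀ x, N x = x + ∑ c, x (A c) • w c := fun _ => rfl
  have hNinj : Function.Injective N := by
    rw [← LinearMap.ker_eq_bot, LinearMap.ker_eq_bot']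
    intro x hx
    have hxR : ∀ R, x R = ∑ c, x (A c) * w c R := by
      intro R
      have := congrFun hx R
      rw [hN, Pi.add_apply, Finset.sum_apply] at this
      simpa using zmodTwo_add_eq_zero_iff.mp this
    -- Only those `c` with `R ∈ S c` contribute to `x R`.
    have hzero : ∀ R, (∀ c, R ∈ S c → x (A c) = 0) → x R = 0 := by
      intro R hR
      rw [hxR]
      refine Finset.sum_eq_zero fun c _ => ?_
      by_cases hc : w c R = 0
      · rw [hc, mul_zero]
      · rw [hR c (hwS c R hc), zero_mul]
    -- The property holds vacuously at `R₀`. On a step from `X` to `Y ∈ S c`, either `X` is in `S c`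
    -- already, or `X = A c`, and then `x (A c) = x X = 0` by `hzero`.
    have hall : ∀ R, ∀ c, R ∈ S c → x (A c) = 0 := by
      refine hP.forall_region (Z := fun R => ∀ c, R ∈ S c → x (A c) = 0) ?_
        (fun c hc => absurd hc (hRS c))
      intro e p X Y he hs hX c hY
      rcases hadj c e p X Y he hs hY with h | h
      · exact hX c h
      · rw [← h]
        exact hzero X hX
    ext R
    exact hzero R (hall R)
  have hNrange : LinearMap.range N = ⊤ :=
    LinearMap.range_eq_top.mpr (LinearMap.injective_iff_surjective.mp hNinj)
  -- The sum over incident regions at `c` is `cornerSum x c + ε c * x (A c)`, and the corner sums of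
  -- `w c` are `ε c` at `c` and 0 elsewhere. As `N` is onto, `M` and `cornerSum` have equal rank.
  have hMN : M.transpose.mulVecLin = K.cornerSum ∘ₗ N := by
    refine LinearMap.ext fun x => ?_
    ext c
    rw [Matrix.mulVecLin_apply, Matrix.mulVec, dotProduct, LinearMap.comp_apply, hN, map_add,
      map_sum, Pi.add_apply, Finset.sum_apply, Finset.sum_eq_single c]
    · rw [map_smul, Pi.smul_apply, hself, smul_eq_mul, mul_comm, ← hsum, Finset.sum_filter]
      refine Finset.sum_congr rfl fun R _ => ?_
      rw [Matrix.transpose_apply, hM]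
      simp only [(K.isCorners c).mem_frontier_iff (mem_support_of_mem_doublePoints c.2)]
      split_ifs <;> simp
    · intro c' _ hc'
      rw [map_smul, Pi.smul_apply, hother c' c hc'.symm, smul_zero]
    · simp
  have hrank := LinearMap.finrank_range_add_finrank_ker K.cornerSum
  rw [K.finrank_ker_cornerSum hP, Module.finrank_fintype_fun_eq_card] at hrank
  rw [← hrank, ← Matrix.rank_transpose, Matrix.rank, hMN,
    LinearMap.range_comp_of_range_eq_top _ hNrange]

end CornerData

end PolygonSystem

/-! ### Transfer from polygons to diagrams -/

namespace LinkDiagram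

variable {n : ℕ} (L : LinkDiagram n)

theorem projection_compl : L.projectionᶜ = L.homeo '' L.polygons.supportᶜ :=
  (Set.image_compl_eq L.homeo.bijective).symm

theorem image_mem_regions_iff {R : Set Plane} :
    L.homeo '' R ∈ L.regions ↔
      ∃ x ∈ L.polygons.supportᶜ, R = connectedComponentIn L.polygons.supportᶜ x := by
  rw [regions, projection_compl]
  constructor
  · rintro ⟨_, ⟨x, hx, rfl⟩, h⟩
    refine ⟨x, hx, ?_⟩
    rw [← L.homeo.image_connectedComponentIn hx] at h
    exact L.homeo.injective.image_injective h
  · rintro ⟨x, hx, rfl⟩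
    exact ⟨L.homeo x, ⟨x, hx, rfl⟩, L.homeo.image_connectedComponentIn hx⟩

/-- The regions of a diagram correspond to the regions of its system of polygons. -/
noncomputable def regionEquiv : L.polygons.Region ≃ L.regions :=
  Equiv.ofBijective (fun R => ⟨L.homeo '' R.1, L.image_mem_regions_iff.mpr R.2⟩) <| by
    constructor
    · intro R S h
      exact Subtype.ext (L.homeo.injective.image_injective (congrArg Subtype.val h))
    · rintro ⟨R, hR⟩
      have h : L.homeo '' (L.homeo.symm '' R) = R := by
        rw [← Set.image_comp]; simp
      rw [← h] at hR
      exact ⟨⟨_, L.image_mem_regions_iff.mp hR⟩, Subtype.ext h⟩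

/-- The crossings of a diagram correspond to the double points of its system of polygons. -/
noncomputable def crossingEquiv : L.polygons.doublePoints ≃ L.crossings :=
  Equiv.Set.image L.homeo _ L.homeo.injective

end LinkDiagram

theorem proposition2 (n : ℕ) (L : LinkDiagram n) :
    L.regions.Finite ∧
      (L.incidenceMatrix.rank : ℤ) = (L.regions.ncard : ℤ) - (n : ℤ) - 1 := by
  classical
  have hfin : Finite L.polygons.Region := L.isRegular.finite_region
  have : Fintype L.polygons.Region := Fintype.ofFinite _
  have : Fintype L.polygons.doublePoints := L.isRegular.finite_doublePoints.fintype
  have hfin' : Finite L.regions := Finite.of_equiv _ L.regionEquiv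
  refine ⟨hfin', ?_⟩
  obtain ⟨K⟩ := L.isRegular.nonempty_cornerData
  -- The homeomorphism preserves components and frontiers, so reindexing turns the incidence matrix
  -- into that of the polygons.
  have hrank := K.rank_incidence L.isRegular
    (L.incidenceMatrix.submatrix L.regionEquiv L.crossingEquiv) (by
      intro R c
      change (if L.homeo (c : Plane) ∈ frontier (L.homeo '' R.1) then (1 : ZMod 2) else 0) = _
      simp only [← L.homeo.image_frontier, L.homeo.injective.mem_set_image])
  rw [Matrix.rank_submatrix] at hrank
  have hcard : L.regions.ncard = Fintype.card L.polygons.Region := by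
    rw [← Nat.card_coe_set_eq, ← Nat.card_congr L.regionEquiv, Nat.card_eq_fintype_card]
  rw [hcard]
  omega
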